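/- Let $\mathcal H\subset L^2[0,1]$ be a separable real reproducing kernel Hilbert space of functions on $[0,1]$ with reproducing kernel $\mathbb K$ such that $\sup_{r}\mathbb K(r,r)\le 1$ and such that, for some constant $C_{\mathcal H}$, $fg\in\mathcal H$ and $\|fg\|_{\mathcal H}\le C_{\mathcal H}\|f\|_{\mathcal H}\|g\|_{\mathcal H}$ for all $f,g\in\mathcal H$. Let $D$ be the order of the model and let $A_1^*,\dots,A_D^*$ be compact linear operators on $\mathcal H$; write $A_d^*(r,s)=\langle A_d^*[\mathbb K(\cdot,s)],\mathbb K(\cdot,r)\rangle_{\mathcal H}$ for the associated bivariate functions. Assume $$\sup_{z\in\mathbb C,\,|z|\le 1}\Big\|\sum_{d=1}^D z^dA_d^*\Big\|_{\mathcal H,\mathrm{op}}=\gamma_A<1,$$ where the norm is the operator norm on the complexification of $\mathcal H$. Let $(\epsilon_t)_{t\in\mathbb Z}$ be i.i.d. $\mathcal H$-valued random elements with $E\epsilon_t(s)=0$ for all $s\in[0,1]$ and $P(\|\epsilon_t\|_{\mathcal H}\le C_\epsilon)=1$ for a constant $C_\epsilon>0$. Consider the FAR($D$) equation $$X_t(r)=\sum_{d=1}^D\int_0^1A_d^*(r,s)X_{t-d}(s)\,ds+\epsilon_t(r),\qquad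 r\in[0,1],\ t\in\mathbb Z.\tag{1}$$ (i) There is a solution $(X_t)_{t\in\mathbb Z}$ of (1) in $\mathcal H$ that is strictly (and also weakly) stationary, and every strictly or weakly stationary solution of (1) in $\mathcal H$ coincides with it almost surely. For each order $D$ there is a positive function $C_X=C_X(C_\epsilon,\gamma_A)$ of $C_\epsilon$ and $\gamma_A$ only, such that $P(\|X_t\|_{\mathcal H}\le C_X)=1$ for all $t$. (ii) There is a positive function $\kappa_X=\kappa_X(\kappa_\epsilon,\gamma_A)$ of $\kappa_\epsilon$ and $\gamma_A$ only (the same for all $D$) such that, if moreover every $A_d^*$ has finite rank and, for some constant $\kappa_\epsilon>0$, $E\big(\int_0^1 v(s)\epsilon_t(s)\,ds\big)^2\ge\kappa_\epsilon\|v\|_{L^2}^2$ for all $v\in\mathcal H$, then for all $t$ $$E\Big(\int_0^1\sum_{d=1}^Dv_d(s)X_{t-d}(s)\,ds\Big)^2\ge\kappa_X\sum_{d=1}^D\|v_d\|_{L^2}^2\qquad\text{for all }v_1,\dots,v_D\in\mathcal H.$$ -/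

import Mathlib

open MeasureTheory ProbabilityTheory
open scoped unitInterval

universe u v

noncomputable section

namespace FAR

section Space

variable (H : Type u) [NormedAddCommGroup H] [InnerProductSpace ℝ H] [CompleteSpace H]
  [RKHS ℝ H I ℝ]

/-- The reproducing kernel `𝕂 (r, s)`: the value at `r` of the representer `𝕂 (·, s)` of
evaluation at `s`. -/
def repKernel (r s : I) : ℝ := (RKHS.kerFun H s (1 : ℝ)) r

/-- `H` is contained in `L²[0,1]`. -/
def SubsetL2 : Prop := ∀ f : H, MemLp (fun s : I => f s) 2 volume

/-- `H` is closed under products and `‖f g‖ ≤ C ‖f‖ ‖g‖` for a constant `C`. -/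
def ProductRegular : Prop :=
  ∃ C : ℝ, ∀ f g : H, ∃ p : H, (∀ s : I, p s = f s * g s) ∧ ‖p‖ ≤ C * ‖f‖ * ‖g‖

/-- `sup_r 𝕂 (r, r) ≤ 1`. -/
def KernelBounded : Prop := ∀ r : I, repKernel H r r ≤ 1

variable {H}

/-- The bivariate function `A (r, s) = ⟨A 𝕂(·, s), 𝕂(·, r)⟩ = (A 𝕂(·, s)) (r)` of an operator `A`
on `H`. -/
def bivariate (A : H →L[ℝ] H) (r s : I) : ℝ := (A (RKHS.kerFun H s (1 : ℝ))) r

/-- The squared `L²[0,1]` norm of an element of `H`. -/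
def l2NormSq (f : H) : ℝ := ∫ s : I, (f s) ^ 2

end Space

section Complexification

variable {H : Type u} [NormedAddCommGroup H] [InnerProductSpace ℝ H]

/-- For real operators `S, T`, the operator `S + i T` on the complexification of `H`. The
complexification is `H × H` with `(x, y)` for `x + i y` and `‖(x, y)‖² = ‖x‖² + ‖y‖²`, so that
`(S + i T) (x + i y) = (S x - T y) + i (T x + S y)`. -/
def complexOp (S T : H →L[ℝ] H) : WithLp 2 (H × H) →L[ℝ] WithLp 2 (H × H) :=
  (WithLp.prodContinuousLinearEquiv 2 ℝ H H).symm.toContinuousLinearMap ∘L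
    ((S ∘L ContinuousLinearMap.fst ℝ H H - T ∘L ContinuousLinearMap.snd ℝ H H).prod
      (T ∘L ContinuousLinearMap.fst ℝ H H + S ∘L ContinuousLinearMap.snd ℝ H H)) ∘L
    (WithLp.prodContinuousLinearEquiv 2 ℝ H H).toContinuousLinearMap

/-- The operator norm of `∑_{d=1}^D z^d A_d` for complex `z`. The lags `d = 1, …, D` are
indexed by `Fin D`, the index `d` standing for the lag `d + 1`. -/
def polyNorm {D : ℕ} (A : Fin D → H →L[ℝ] H) (z : ℂ) : ℝ :=
  ‖complexOp (∑ d : Fin D, (z ^ ((d : ℕ) + 1)).re • A d)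
    (∑ d : Fin D, (z ^ ((d : ℕ) + 1)).im • A d)‖

/-- `sup_{|z| ≤ 1} ‖∑_{d=1}^D z^d A_d‖ = γ`. -/
def HasPolySup {D : ℕ} (A : Fin D → H →L[ℝ] H) (γ : ℝ) : Prop :=
  IsLUB (polyNorm A '' Metric.closedBall (0 : ℂ) 1) γ

end Complexification

section TimeSeries

variable {Ω : Type v} [MeasurableSpace Ω] {H : Type u} [NormedAddCommGroup H]
  [InnerProductSpace ℝ H] [MeasurableSpace H]

/-- `(ε_t)_{t ∈ ℤ}` are independent identically distributed `H`-valued random variables. -/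
structure IsIIDNoise (ε : ℤ → Ω → H) (P : Measure Ω) : Prop where
  measurable : ∀ t, Measurable (ε t)
  indep : iIndepFun ε P
  identDistrib : ∀ t, IdentDistrib (ε t) (ε 0) P P

/-- Strict stationarity: the law of the whole process is invariant under time shifts. -/
def StrictlyStationary (X : ℤ → Ω → H) (P : Measure Ω) : Prop :=
  ∀ h : ℤ, IdentDistrib (fun ω t => X (t + h) ω) (fun ω t => X t ω) P P

/-- Weak stationarity: second moments, constant mean, shift-invariant (cross-)covariances. -/
structure WeaklyStationary (X : ℤ → Ω → H) (P : Measure Ω) : Prop where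
  memLp : ∀ t, MemLp (X t) 2 P
  mean : ∀ s t, ∫ ω, X s ω ∂P = ∫ ω, X t ω ∂P
  cov : ∀ (h s t : ℤ) (x y : H),
    covariance (fun ω => inner ℝ (X (s + h) ω) x) (fun ω => inner ℝ (X (t + h) ω) y) P =
      covariance (fun ω => inner ℝ (X s ω) x) (fun ω => inner ℝ (X t ω) y) P

variable [CompleteSpace H] [RKHS ℝ H I ℝ]

/-- `(X_t)_{t ∈ ℤ}` consists of random elements of `H` and solves, for every `t`, almost surely,
`X_t (r) = ∑_{d=1}^D ∫ A_d (r, s) X_{t-d} (s) ds + ε_t (r)` for all `r ∈ [0,1]`. -/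
structure SolvesFAR {D : ℕ} (A : Fin D → H →L[ℝ] H) (ε X : ℤ → Ω → H) (P : Measure Ω) :
    Prop where
  measurable : ∀ t, Measurable (X t)
  eqn : ∀ t, ∀ᵐ ω ∂P, ∀ r : I,
    X t ω r =
    (∑ d : Fin D, ∫ s : I, bivariate (A d) r s * X (t - ((d : ℤ) + 1)) ω s) + ε t ω r

/-- The noise is nondegenerate: `E (∫ v ε_t)² ≥ κ ‖v‖²_{L²}` for all `v ∈ H`. -/
def NoiseLowerBound (ε : ℤ → Ω → H) (P : Measure Ω) (κ : ℝ) : Prop :=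
  ∀ (t : ℤ) (v : H), κ * l2NormSq v ≤ ∫ ω, (∫ s : I, v s * ε t ω s) ^ 2 ∂P

/-- The restricted eigenvalue condition with constant `κ`, for all `t` and `v_1, …, v_D ∈ H`:
`E (∫ ∑_{d=1}^D v_d (s) X_{t-d} (s) ds)² ≥ κ ∑_{d=1}^D ‖v_d‖²_{L²}`. -/
def RestrictedEigenvalue (D : ℕ) (X : ℤ → Ω → H) (P : Measure Ω) (κ : ℝ) : Prop :=
  ∀ (t : ℤ) (v : Fin D → H), κ * ∑ d : Fin D, l2NormSq (v d) ≤
    ∫ ω, (∫ s : I, ∑ d : Fin D, v d s * X (t - ((d : ℤ) + 1)) ω s) ^ 2 ∂P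

end TimeSeries

end FAR

end

/-! Parseval's identity turns the bound on `∑ z^d A_d` over the unit circle into a contraction: the
lag operator has norm at most `γ` on square summable `H`-valued sequences, and by causality also on
windows of sequences vanishing before the window (`lagBound_of_polyNorm_le`). The `L²` pairing on
`H` is `⟨g, T f⟩` with `‖T‖ ≤ 1`, so the model reads `X = L X + ε`, where `L` has coefficients `A_d
∘ T` and is still a contraction.

Existence: `L^k ε` at time `t` only involves the noise on `[t - kD, t]`, so the `ℓ²` bound becomes a
pointwise bound of order `γ^k (kD + 1)`. The Neumann series converges and is a shift-equivariant
function of the noise, hence stationary.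

Uniqueness: the difference `Z` of two solutions satisfies `Z = L Z`. Cutting `Z` at a time `τ`
bounds the energy of its future by the `D` values ending at `τ`; averaging over many `τ` gives `n
‖Z_t‖² ≤ K · (past block)²`. Stationarity bounds the past block in probability, so `Z_t = 0` almost
surely.

Eigenvalue bound: let `u` solve the dual recursion `u = L' u + v` with coefficients `A_d^* ∘ T`.
Summation by parts turns the functional of `X` into `∑ ⟨T u_j, ε_{t-j}⟩` plus a remainder in `X`
before `t - D`, orthogonal to those noises. Hence the second moment is at least `κ ∑ ‖u_j‖²_{L²}`,
while the contraction for the adjoints gives `∑ ‖v_j‖²_{L²} ≤ 4 ∑ ‖u_j‖²_{L²}`. -/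

set_option linter.unusedSectionVars false

namespace FAR

/-! ### Fourier analysis of the lag operator -/

section LagOp

variable {H : Type u} [NormedAddCommGroup H] [InnerProductSpace ℝ H]

lemma complexOp_apply (S T : H →L[ℝ] H) (p : WithLp 2 (H × H)) :
    complexOp S T p = WithLp.toLp 2 (S p.fst - T p.snd, T p.fst + S p.snd) := rfl

/-- The lag operator `(w_t) ↦ (∑_d B_d w_{t-d})` on two-sided sequences. -/
noncomputable def lagOp {D : ℕ} (B : Fin D → H →L[ℝ] H) (w : ℤ → H) (t : ℤ) : H :=
  ∑ d : Fin D, B d (w (t - ((d : ℤ) + 1)))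

/-- The trigonometric polynomial `∑_{t ∈ s} exp (i t θ) w_t` in the complexification. -/
noncomputable def trigSum (s : Finset ℤ) (w : ℤ → H) (θ : ℝ) : WithLp 2 (H × H) :=
  WithLp.toLp 2 (∑ t ∈ s, Real.cos (t * θ) • w t, ∑ t ∈ s, Real.sin (t * θ) • w t)

lemma norm_sq_trigSum (s : Finset ℤ) (w : ℤ → H) (θ : ℝ) :
    ‖trigSum s w θ‖ ^ 2 =
      ∑ i ∈ s, ∑ j ∈ s, Real.cos (((i - j : ℤ) : ℝ) * θ) * inner ℝ (w i) (w j) := by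
  rw [WithLp.prod_norm_sq_eq_of_L2]
  simp only [trigSum, WithLp.toLp_fst, WithLp.toLp_snd, ← real_inner_self_eq_norm_sq, sum_inner, inner_sum, real_inner_smul_left,
    real_inner_smul_right]
  rw [← Finset.sum_add_distrib]
  refine Finset.sum_congr rfl fun i _ => ?_
  rw [← Finset.sum_add_distrib]
  refine Finset.sum_congr rfl fun j _ => ?_
  push_cast
  rw [sub_mul, Real.cos_sub, real_inner_comm (w i) (w j)]
  ring

lemma integral_cos_int_mul (n : ℤ) :
    ∫ θ in (0 : ℝ)..(2 * Real.pi), Real.cos ((n : ℝ) * θ) = if n = 0 then 2 * Real.pi else 0 := by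
  split_ifs with h
  · simp [h]
  · have h' : (n : ℝ) ≠ 0 := by exact_mod_cast h
    rw [intervalIntegral.integral_comp_mul_left (fun x => Real.cos x) h', integral_cos]
    have : Real.sin ((n : ℝ) * (2 * Real.pi)) = 0 := by
      rw [show (n : ℝ) * (2 * Real.pi) = ((2 * n : ℤ) : ℝ) * Real.pi by push_cast; ring]
      exact Real.sin_int_mul_pi _
    simp [this]

lemma continuous_norm_sq_trigSum (s : Finset ℤ) (w : ℤ → H) :
    Continuous fun θ => ‖trigSum s w θ‖ ^ 2 := by
  simp only [norm_sq_trigSum]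
  fun_prop

/-- Parseval: integrating over a period kills the off-diagonal terms of the double sum. -/
lemma integral_norm_sq_trigSum (s : Finset ℤ) (w : ℤ → H) :
    ∫ θ in (0 : ℝ)..(2 * Real.pi), ‖trigSum s w θ‖ ^ 2 =
      2 * Real.pi * ∑ t ∈ s, ‖w t‖ ^ 2 := by
  simp only [norm_sq_trigSum]
  rw [intervalIntegral.integral_finsetSum, Finset.mul_sum]
  · refine Finset.sum_congr rfl fun i hi => ?_
    rw [intervalIntegral.integral_finsetSum]
    · simp only [intervalIntegral.integral_mul_const, integral_cos_int_mul, sub_eq_zero, ite_mul,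
        zero_mul]
      rw [Finset.sum_ite_eq, if_pos hi, real_inner_self_eq_norm_sq]
    · intro j _
      exact Continuous.intervalIntegrable (by fun_prop) _ _
  · intro i _
    exact Continuous.intervalIntegrable (by fun_prop) _ _

lemma sum_shift_eq {M : Type*} [AddCommMonoid M] {a b c : ℤ} {n : ℤ}
    (h0 : 0 ≤ n) (hc : b + n ≤ c) (F : ℤ → M)
    (hF : ∀ t, t ∉ Finset.Icc a b → F t = 0) :
    ∑ t ∈ Finset.Icc a c, F (t - n) = ∑ t ∈ Finset.Icc a b, F t := by
  symm
  refine Finset.sum_of_injOn (fun t => t + n) (fun x _ y _ h => by simpa using h) ?_ ?_ ?_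
  · intro t ht
    simp only [Finset.coe_Icc, Set.mem_Icc] at ht ⊢
    omega
  · intro t _ ht
    refine hF _ fun h => ht ⟨t - n, by simpa using h, by simp⟩
  · intro t _
    simp

/-- A delay by `d + 1` multiplies the transform by `exp (i (d + 1) θ)`. The window grows by `D` on
the right so that no delayed term is lost. -/
lemma trigSum_lagOp {D : ℕ} (B : Fin D → H →L[ℝ] H) (w : ℤ → H) {a b : ℤ}
    (hw : ∀ t, t ∉ Finset.Icc a b → w t = 0) (θ : ℝ) :
    trigSum (Finset.Icc a (b + D)) (lagOp B w) θ =
      complexOp (∑ d : Fin D, (Complex.exp (θ * Complex.I) ^ ((d : ℕ) + 1)).re • B d)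
        (∑ d : Fin D, (Complex.exp (θ * Complex.I) ^ ((d : ℕ) + 1)).im • B d)
        (trigSum (Finset.Icc a b) w θ) := by
  have hz : ∀ d : Fin D, Complex.exp (θ * Complex.I) ^ ((d : ℕ) + 1) =
      Complex.exp (((((d : ℤ) + 1 : ℤ) : ℝ) * θ : ℝ) * Complex.I) := by
    intro d
    rw [← Complex.exp_nat_mul]
    congr 1
    push_cast
    ring
  have key : ∀ c : ℝ → ℝ, ∑ t ∈ Finset.Icc a (b + D), c (t * θ) • lagOp B w t =
      ∑ d : Fin D, ∑ t ∈ Finset.Icc a b,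
        c (t * θ + (((d : ℤ) + 1 : ℤ) : ℝ) * θ) • B d (w t) := by
    intro c
    simp only [lagOp, Finset.smul_sum]
    rw [Finset.sum_comm]
    refine Finset.sum_congr rfl fun d _ => ?_
    rw [← sum_shift_eq (a := a) (b := b) (c := b + D) (n := (d : ℤ) + 1) (by omega)
      (by have := d.2; omega)]
    · refine Finset.sum_congr rfl fun t _ => ?_
      push_cast
      congr 2
      ring
    · intro t ht
      simp [hw t ht]
  rw [complexOp_apply]
  simp only [trigSum, key, hz, Complex.exp_ofReal_mul_I_re, Complex.exp_ofReal_mul_I_im]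
  congr 2
  · simp only [sum_apply, smul_apply]
    rw [← Finset.sum_sub_distrib]
    refine Finset.sum_congr rfl fun d _ => ?_
    simp only [WithLp.toLp_fst, WithLp.toLp_snd, map_sum, map_smul, Finset.smul_sum]
    rw [← Finset.sum_sub_distrib]
    refine Finset.sum_congr rfl fun t _ => ?_
    rw [Real.cos_add, smul_smul, smul_smul, ← sub_smul]
    congr 1
    ring
  · simp only [sum_apply, smul_apply]
    rw [← Finset.sum_add_distrib]
    refine Finset.sum_congr rfl fun d _ => ?_
    simp only [WithLp.toLp_fst, WithLp.toLp_snd, map_sum, map_smul, Finset.smul_sum]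
    rw [← Finset.sum_add_distrib]
    refine Finset.sum_congr rfl fun t _ => ?_
    rw [Real.sin_add, smul_smul, smul_smul, ← add_smul]
    congr 1
    ring

/-- The lag operator has norm at most `γ` on square summable sequences, in causal form: for
sequences that vanish before `a`, windows `[a, b]` are contracted by `γ`. -/
def LagBound {D : ℕ} (B : Fin D → H →L[ℝ] H) (γ : ℝ) : Prop :=
  ∀ (w : ℤ → H) (a b : ℤ), (∀ t < a, w t = 0) →
    ∑ t ∈ Finset.Icc a b, ‖lagOp B w t‖ ^ 2 ≤ γ ^ 2 * ∑ t ∈ Finset.Icc a b, ‖w t‖ ^ 2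

lemma lagOp_congr {D : ℕ} (B : Fin D → H →L[ℝ] H) {w w' : ℤ → H} {t : ℤ}
    (h : ∀ s, t - D ≤ s → s < t → w s = w' s) : lagOp B w t = lagOp B w' t := by
  refine Finset.sum_congr rfl fun d _ => ?_
  rw [h _ (by have := d.2; omega) (by omega)]

theorem lagBound_of_polyNorm_le {D : ℕ} {B : Fin D → H →L[ℝ] H} {γ : ℝ}
    (hB : ∀ z : ℂ, ‖z‖ ≤ 1 → polyNorm B z ≤ γ) : LagBound B γ := by
  classical
  intro w a b hw
  -- By causality, cutting `w` off after `b` leaves `lagOp B w` unchanged on `[a, b]`, and Parseval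
  -- needs finite support.
  set w' : ℤ → H := fun t => if t ∈ Finset.Icc a b then w t else 0 with hw'
  have h0 : ∀ t, t ∉ Finset.Icc a b → w' t = 0 := fun t ht => by simp only [hw', if_neg ht]
  have h1 : ∑ t ∈ Finset.Icc a b, ‖lagOp B w t‖ ^ 2 ≤
      ∑ t ∈ Finset.Icc a (b + D), ‖lagOp B w' t‖ ^ 2 := by
    calc _ = ∑ t ∈ Finset.Icc a b, ‖lagOp B w' t‖ ^ 2 := by
          refine Finset.sum_congr rfl fun t ht => ?_
          rw [lagOp_congr B (w' := w')]
          intro s _ hs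
          rw [Finset.mem_Icc] at ht
          by_cases hsa : s < a
          · rw [hw s hsa, h0 s (by rw [Finset.mem_Icc]; omega)]
          · simp only [hw']
            rw [if_pos (by rw [Finset.mem_Icc]; omega)]
      _ ≤ _ := Finset.sum_le_sum_of_subset_of_nonneg
          (Finset.Icc_subset_Icc le_rfl (by omega)) fun _ _ _ => by positivity
  have h2 : ∑ t ∈ Finset.Icc a b, ‖w' t‖ ^ 2 = ∑ t ∈ Finset.Icc a b, ‖w t‖ ^ 2 :=
    Finset.sum_congr rfl fun t ht => by simp only [hw', if_pos ht]
  have hpi : (0 : ℝ) < 2 * Real.pi := by positivity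
  have h3 : ∫ θ in (0 : ℝ)..(2 * Real.pi), ‖trigSum (Finset.Icc a (b + D)) (lagOp B w') θ‖ ^ 2 ≤
      ∫ θ in (0 : ℝ)..(2 * Real.pi), γ ^ 2 * ‖trigSum (Finset.Icc a b) w' θ‖ ^ 2 := by
    refine intervalIntegral.integral_mono_on hpi.le
      ((continuous_norm_sq_trigSum _ _).intervalIntegrable _ _)
      (((continuous_norm_sq_trigSum _ _).const_mul _).intervalIntegrable _ _) fun θ _ => ?_
    rw [trigSum_lagOp B w' h0, ← mul_pow]
    gcongr
    refine (ContinuousLinearMap.le_opNorm _ _).trans ?_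
    gcongr
    exact hB _ (Complex.norm_exp_ofReal_mul_I θ).le
  rw [intervalIntegral.integral_const_mul, integral_norm_sq_trigSum, integral_norm_sq_trigSum,
    h2] at h3
  refine h1.trans (le_of_mul_le_mul_left ?_ hpi)
  linarith

lemma LagBound.comp {D : ℕ} {B : Fin D → H →L[ℝ] H} {γ : ℝ} (h : LagBound B γ)
    {T : H →L[ℝ] H} (hT : ‖T‖ ≤ 1) : LagBound (fun d => B d ∘L T) γ := by
  intro w a b hw
  refine (h (fun t => T (w t)) a b fun t ht => by simp [hw t ht]).trans ?_
  gcongr with t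
  exact (T.le_of_opNorm_le hT _).trans_eq (one_mul _)

section Adjoint

variable [CompleteSpace H]

lemma adjoint_complexOp (S T : H →L[ℝ] H) :
    ContinuousLinearMap.adjoint (complexOp S T) =
      complexOp (ContinuousLinearMap.adjoint S) (-ContinuousLinearMap.adjoint T) := by
  symm
  rw [ContinuousLinearMap.eq_adjoint_iff]
  intro x y
  simp only [complexOp_apply, WithLp.prod_inner_apply, ← WithLp.ofLp_fst, ← WithLp.ofLp_snd, inner_sub_left, inner_add_left,
    inner_sub_right, inner_add_right, neg_apply, inner_neg_left,
    ContinuousLinearMap.adjoint_inner_left]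
  ring

/-- The unit disc is invariant under conjugation, so the adjoint coefficients inherit the bound `γ`,
as the dual recursion requires. -/
lemma polyNorm_adjoint {D : ℕ} (B : Fin D → H →L[ℝ] H) (z : ℂ) :
    polyNorm (fun d => ContinuousLinearMap.adjoint (B d)) z =
      polyNorm B (starRingEnd ℂ z) := by
  unfold polyNorm
  conv_rhs => rw [← LinearIsometryEquiv.norm_map ContinuousLinearMap.adjoint, adjoint_complexOp]
  congr 2
  · simp [← map_pow, -map_mul]
  · simp [← map_pow, -map_mul]

end Adjoint

end LagOp

end FAR

namespace FAR

/-! ### Neumann series and homogeneous solutions, pathwise -/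

section Deterministic

/-- The size of a sequence over the `D` time points ending at `τ`. -/
noncomputable def blockNorm {E : Type*} [NormedAddCommGroup E] (D : ℕ) (Z : ℤ → E) (τ : ℤ) : ℝ :=
  ∑ i ∈ Finset.range D, ‖Z (τ - i)‖

lemma blockNorm_nonneg {E : Type*} [NormedAddCommGroup E] (D : ℕ) (Z : ℤ → E) (τ : ℤ) : 0 ≤ blockNorm D Z τ :=
  Finset.sum_nonneg fun _ _ => norm_nonneg _

variable {H : Type u} [NormedAddCommGroup H] [InnerProductSpace ℝ H] {D : ℕ}
  {B : Fin D → H →L[ℝ] H} {γ : ℝ}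

lemma lagOp_eq_zero (B : Fin D → H →L[ℝ] H) {w : ℤ → H} {a : ℤ} (hw : ∀ t < a, w t = 0) :
    ∀ t < a, lagOp B w t = 0 := by
  intro t ht
  refine Finset.sum_eq_zero fun d _ => ?_
  rw [hw _ (by omega), map_zero]

lemma iterate_lagOp_eq_zero (B : Fin D → H →L[ℝ] H) {w : ℤ → H} {a : ℤ}
    (hw : ∀ t < a, w t = 0) (k : ℕ) : ∀ t < a, (lagOp B)^[k] w t = 0 := by
  induction k with
  | zero => exact hw
  | succ k ih =>
    rw [Function.iterate_succ_apply']
    exact lagOp_eq_zero B ih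

lemma iterate_lagOp_congr (B : Fin D → H →L[ℝ] H) {w w' : ℤ → H} (k : ℕ) {t : ℤ}
    (h : ∀ s, t - (k * D : ℕ) ≤ s → s ≤ t → w s = w' s) :
    (lagOp B)^[k] w t = (lagOp B)^[k] w' t := by
  induction k generalizing t with
  | zero => exact h t (by simp) le_rfl
  | succ k ih =>
    rw [Function.iterate_succ_apply', Function.iterate_succ_apply']
    refine lagOp_congr B fun s hs hst => ih fun r hr hrs => h r ?_ (by omega)
    push_cast at hr ⊢
    rw [add_mul]
    linarith

lemma LagBound.iterate (hB : LagBound B γ) {w : ℤ → H} {a : ℤ} (b : ℤ)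
    (hw : ∀ t < a, w t = 0) (k : ℕ) :
    ∑ t ∈ Finset.Icc a b, ‖(lagOp B)^[k] w t‖ ^ 2 ≤
      (γ ^ k) ^ 2 * ∑ t ∈ Finset.Icc a b, ‖w t‖ ^ 2 := by
  induction k with
  | zero => simp
  | succ k ih =>
    rw [Function.iterate_succ_apply']
    refine (hB _ a b (iterate_lagOp_eq_zero B hw k)).trans ?_
    calc _ ≤ γ ^ 2 * ((γ ^ k) ^ 2 * ∑ t ∈ Finset.Icc a b, ‖w t‖ ^ 2) := by gcongr
      _ = _ := by ring

/-- Finite memory turns the `ℓ²` contraction into a pointwise bound: only the `kD + 1` inputs on `[t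
- kD, t]` matter. -/
lemma LagBound.norm_iterate_le (hB : LagBound B γ) (hγ : 0 ≤ γ) {e : ℤ → H} {C : ℝ}
    (he : ∀ t, ‖e t‖ ≤ C) (k : ℕ) (t : ℤ) :
    ‖(lagOp B)^[k] e t‖ ≤ C * (γ ^ k * ((k * D : ℕ) + 1)) := by
  have hC : 0 ≤ C := (norm_nonneg _).trans (he 0)
  set a : ℤ := t - (k * D : ℕ) with ha
  set w : ℤ → H := fun s => if s < a then 0 else e s with hw
  have h1 : (lagOp B)^[k] e t = (lagOp B)^[k] w t := by
    refine iterate_lagOp_congr B k fun s hs _ => ?_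
    simp only [hw]
    rw [if_neg (by omega)]
  have h2 : ‖(lagOp B)^[k] w t‖ ^ 2 ≤ ∑ s ∈ Finset.Icc a t, ‖(lagOp B)^[k] w s‖ ^ 2 :=
    Finset.single_le_sum (f := fun s => ‖(lagOp B)^[k] w s‖ ^ 2) (fun _ _ => by positivity)
      (Finset.mem_Icc.2 ⟨by omega, le_rfl⟩)
  have h3 : ∑ s ∈ Finset.Icc a t, ‖w s‖ ^ 2 ≤ ((k * D : ℕ) + 1) * C ^ 2 := by
    calc _ ≤ ∑ s ∈ Finset.Icc a t, C ^ 2 := by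
          refine Finset.sum_le_sum fun s hs => ?_
          rw [Finset.mem_Icc] at hs
          simp only [hw]
          rw [if_neg (by omega)]
          gcongr
          exact he s
      _ = _ := by
          rw [Finset.sum_const, Int.card_Icc, nsmul_eq_mul,
            show (t + 1 - a).toNat = k * D + 1 by omega]
          push_cast
          ring
  rw [h1]
  refine abs_le_of_sq_le_sq' ?_ (by positivity) |>.2
  refine (h2.trans (hB.iterate t (fun s hs => by simp only [hw, if_pos hs]) k)).trans ?_
  calc _ ≤ (γ ^ k) ^ 2 * (((k * D : ℕ) + 1) * C ^ 2) := by gcongr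
    -- Replacing `kD + 1` by its square avoids a square root; the series still converges.
    _ ≤ (γ ^ k) ^ 2 * ((((k * D : ℕ) + 1) ^ 2) * C ^ 2) := by
        gcongr
        exact le_self_pow₀ (by norm_cast; omega) two_ne_zero
    _ = _ := by ring

lemma summable_geometric_mul_linear (hγ : 0 ≤ γ) (hγ1 : γ < 1) (D : ℕ) :
    Summable fun k : ℕ => γ ^ k * (((k * D : ℕ) : ℝ) + 1) := by
  have h1 : Summable fun k : ℕ => (k : ℝ) ^ 1 * γ ^ k :=
    summable_pow_mul_geometric_of_norm_lt_one 1 (by rwa [Real.norm_of_nonneg hγ])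
  refine ((h1.mul_right (D : ℝ)).add (summable_geometric_of_lt_one hγ hγ1)).congr fun k => ?_
  push_cast
  ring

/-- The causal moving average `∑_k (lagOp B)^k e`, the solution of `X = lagOp B X + e`. -/
noncomputable def neumann (B : Fin D → H →L[ℝ] H) (e : ℤ → H) (t : ℤ) : H :=
  ∑' k : ℕ, (lagOp B)^[k] e t

lemma neumann_eq_zero (B : Fin D → H →L[ℝ] H) {e : ℤ → H} {a : ℤ} (he : ∀ t < a, e t = 0) :
    ∀ t < a, neumann B e t = 0 := by
  intro t ht
  simp only [neumann, iterate_lagOp_eq_zero B he _ t ht, tsum_zero]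

lemma LagBound.norm_neumann_le (hB : LagBound B γ) (hγ : 0 ≤ γ) (hγ1 : γ < 1) {e : ℤ → H}
    {C : ℝ} (he : ∀ t, ‖e t‖ ≤ C) (t : ℤ) :
    ‖neumann B e t‖ ≤ C * ∑' k : ℕ, γ ^ k * (((k * D : ℕ) : ℝ) + 1) := by
  rw [← tsum_mul_left]
  exact tsum_of_norm_bounded ((summable_geometric_mul_linear hγ hγ1 D).mul_left C).hasSum
    fun k => hB.norm_iterate_le hγ he k t

section Complete

variable [CompleteSpace H]

lemma LagBound.hasSum_neumann (hB : LagBound B γ) (hγ : 0 ≤ γ) (hγ1 : γ < 1) {e : ℤ → H}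
    {C : ℝ} (he : ∀ t, ‖e t‖ ≤ C) (t : ℤ) :
    HasSum (fun k => (lagOp B)^[k] e t) (neumann B e t) :=
  (Summable.of_norm_bounded ((summable_geometric_mul_linear hγ hγ1 D).mul_left C)
    fun k => hB.norm_iterate_le hγ he k t).hasSum

lemma LagBound.neumann_eq (hB : LagBound B γ) (hγ : 0 ≤ γ) (hγ1 : γ < 1) {e : ℤ → H}
    {C : ℝ} (he : ∀ t, ‖e t‖ ≤ C) (t : ℤ) :
    neumann B e t = lagOp B (neumann B e) t + e t := by
  have h1 : HasSum (fun k => (lagOp B)^[k + 1] e t) (lagOp B (neumann B e) t) := by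
    simp only [Function.iterate_succ_apply']
    exact hasSum_sum fun d _ => (hB.hasSum_neumann hγ hγ1 he _).mapL (B d)
  have h2 := (hasSum_nat_add_iff' 1).2 (hB.hasSum_neumann hγ hγ1 he t)
  have h3 := h1.unique h2
  rw [h3]
  simp

end Complete

lemma norm_add_sq_le_weighted {E : Type*} [SeminormedAddCommGroup E] {δ : ℝ} (hδ : 0 < δ)
    (x y : E) :
    ‖x + y‖ ^ 2 ≤ (1 + δ) * ‖x‖ ^ 2 + (1 + δ⁻¹) * ‖y‖ ^ 2 := by
  have h1 : ‖x + y‖ ^ 2 ≤ (‖x‖ + ‖y‖) ^ 2 := by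
    gcongr
    exact norm_add_le x y
  have h2 : 0 ≤ δ * (‖x‖ - δ⁻¹ * ‖y‖) ^ 2 := by positivity
  have h3 : δ * (‖x‖ - δ⁻¹ * ‖y‖) ^ 2 =
      δ * ‖x‖ ^ 2 - 2 * ‖x‖ * ‖y‖ + δ⁻¹ * ‖y‖ ^ 2 := by
    field_simp
    ring
  nlinarith

/-- The future of a solution of the homogeneous equation is square summable, with a bound by the
present. -/
lemma LagBound.exists_sum_norm_sq_le (hB : LagBound B γ) (hγ : 0 ≤ γ) (hγ1 : γ < 1) :
    ∃ K : ℝ, 0 ≤ K ∧ ∀ Z : ℤ → H, (∀ t, Z t = lagOp B Z t) → ∀ τ b : ℤ,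
      ∑ s ∈ Finset.Icc (τ + 1) b, ‖Z s‖ ^ 2 ≤ K * blockNorm D Z τ ^ 2 := by
  have hδ : 0 < 1 - γ := by linarith
  set β : ℝ := ∑ d, ‖B d‖ with hβ
  refine ⟨(1 - γ)⁻¹ * ((1 + (1 - γ)⁻¹) * (D * β ^ 2)), by positivity, fun Z hZ τ b => ?_⟩
  set W : ℤ → H := fun t => if t ≤ τ then 0 else Z t with hW
  set V : ℤ → H := fun t => if t ≤ τ then Z t else 0 with hV
  have hZW : ∀ s ∈ Finset.Icc (τ + 1) b, Z s = W s := fun s hs => by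
    rw [Finset.mem_Icc] at hs
    simp only [hW]
    rw [if_neg (by omega)]
  have hsplit : ∀ s, lagOp B Z s = lagOp B W s + lagOp B V s := by
    intro s
    simp only [lagOp, ← Finset.sum_add_distrib, ← map_add]
    refine Finset.sum_congr rfl fun d _ => ?_
    congr 1
    simp only [hW, hV]
    split_ifs <;> simp
  have hVs : ∀ s ∈ Finset.Icc (τ + 1) b, ‖lagOp B V s‖ ^ 2 ≤
      if s ∈ Finset.Icc (τ + 1) (τ + D) then (β * blockNorm D Z τ) ^ 2 else 0 := by
    intro s hs
    rw [Finset.mem_Icc] at hs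
    split_ifs with h
    · gcongr
      refine (norm_sum_le _ _).trans ?_
      rw [hβ, Finset.sum_mul]
      refine Finset.sum_le_sum fun d _ => (B d).le_of_opNorm_le_of_le le_rfl ?_
      simp only [hV]
      split_ifs with h'
      · have := Finset.single_le_sum (f := fun i : ℕ => ‖Z (τ - i)‖) (s := Finset.range D)
          (fun _ _ => norm_nonneg _) (a := (τ - (s - ((d : ℤ) + 1))).toNat)
          (Finset.mem_range.2 (by have := d.2; omega))
        refine le_trans (le_of_eq ?_) this
        congr 2
        omega
      · simpa using blockNorm_nonneg D Z τ
    · rw [lagOp_congr B (w' := fun _ => 0)]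
      · simp [lagOp]
      · intro r hr _
        simp only [hV]
        rw [if_neg]
        rw [Finset.mem_Icc] at h
        omega
  have hVsum : ∑ s ∈ Finset.Icc (τ + 1) b, ‖lagOp B V s‖ ^ 2 ≤
      D * β ^ 2 * blockNorm D Z τ ^ 2 := by
    refine (Finset.sum_le_sum hVs).trans ?_
    rw [← Finset.sum_filter, Finset.sum_const, nsmul_eq_mul]
    have : ((Finset.Icc (τ + 1) b).filter (· ∈ Finset.Icc (τ + 1) (τ + D))).card ≤ D := by
      refine (Finset.card_le_card fun s hs => (Finset.mem_filter.1 hs).2).trans ?_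
      simp
    rw [mul_pow, ← mul_assoc]
    gcongr
  have hWsum := hB W (τ + 1) b fun t ht => by
    simp only [hW]
    rw [if_pos (by omega)]
  have hmain : ∑ s ∈ Finset.Icc (τ + 1) b, ‖W s‖ ^ 2 ≤
      (1 + (1 - γ)) * (γ ^ 2 * ∑ s ∈ Finset.Icc (τ + 1) b, ‖W s‖ ^ 2) +
        (1 + (1 - γ)⁻¹) * (D * β ^ 2 * blockNorm D Z τ ^ 2) := by
    calc _ ≤ ∑ s ∈ Finset.Icc (τ + 1) b, ((1 + (1 - γ)) * ‖lagOp B W s‖ ^ 2 +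
          (1 + (1 - γ)⁻¹) * ‖lagOp B V s‖ ^ 2) := by
          refine Finset.sum_le_sum fun s hs => ?_
          rw [← hZW s hs, hZ s, hsplit s]
          exact norm_add_sq_le_weighted hδ _ _
      _ ≤ _ := by
          rw [Finset.sum_add_distrib, ← Finset.mul_sum, ← Finset.mul_sum]
          gcongr
  rw [Finset.sum_congr rfl fun s hs => by rw [hZW s hs]]
  set S := ∑ s ∈ Finset.Icc (τ + 1) b, ‖W s‖ ^ 2
  have hS : 0 ≤ S := Finset.sum_nonneg fun _ _ => by positivity
  set R := (1 + (1 - γ)⁻¹) * (D * β ^ 2 * blockNorm D Z τ ^ 2)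
  have hc : (1 - γ) * S ≤ R := by
    -- With weight `δ = 1 - γ` the factor `(1 + δ) γ²` is at most `γ`, so the energy of `W` can be
    -- absorbed on the left.
    have : γ * (γ * (2 - γ)) ≤ γ := by nlinarith [mul_nonneg hγ (sq_nonneg (1 - γ))]
    nlinarith
  calc S = (1 - γ)⁻¹ * ((1 - γ) * S) := by field_simp
    _ ≤ (1 - γ)⁻¹ * R := by gcongr
    _ = _ := by simp only [R]; ring

/-- Solutions of the homogeneous equation are controlled by their remote past. -/
lemma LagBound.exists_mul_norm_sq_le (hB : LagBound B γ) (hγ : 0 ≤ γ) (hγ1 : γ < 1) :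
    ∃ K : ℝ, 0 ≤ K ∧ ∀ Z : ℤ → H, (∀ t, Z t = lagOp B Z t) → ∀ (t : ℤ) (n : ℕ),
      n * ‖Z t‖ ^ 2 ≤ K * blockNorm D Z (t - D - n) ^ 2 := by
  obtain ⟨K, hK, h⟩ := hB.exists_sum_norm_sq_le hγ hγ1
  refine ⟨K * (D * (D * K)), by positivity, fun Z hZ t n => ?_⟩
  set ρ : ℤ := t - D - n with hρ
  -- The energy bound is used from each of the `n` times `τ` and summed. The resulting blocks lie
  -- after `ρ`, where a second use of the energy bound, now from `ρ`, controls them independently of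
  -- `n`.
  have h1 : ∀ τ ∈ Finset.Icc (ρ + D) (t - 1), ‖Z t‖ ^ 2 ≤
      K * (D * ∑ i ∈ Finset.range D, ‖Z (τ - i)‖ ^ 2) := by
    intro τ hτ
    rw [Finset.mem_Icc] at hτ
    calc ‖Z t‖ ^ 2 ≤ ∑ s ∈ Finset.Icc (τ + 1) t, ‖Z s‖ ^ 2 :=
          Finset.single_le_sum (f := fun s => ‖Z s‖ ^ 2) (fun _ _ => by positivity)
            (Finset.mem_Icc.2 ⟨by omega, le_rfl⟩)
      _ ≤ K * blockNorm D Z τ ^ 2 := h Z hZ τ t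
      _ ≤ _ := by
          gcongr
          have := sq_sum_le_card_mul_sum_sq (s := Finset.range D) (f := fun i => ‖Z (τ - i)‖)
          simpa [blockNorm] using this
  have h2 := Finset.sum_le_sum h1
  rw [Finset.sum_const, Int.card_Icc, nsmul_eq_mul, show (t - 1 + 1 - (ρ + D)).toNat = n by omega,
    ← Finset.mul_sum, ← Finset.mul_sum, Finset.sum_comm] at h2
  refine h2.trans ?_
  have h3 : ∀ i ∈ Finset.range D, ∑ τ ∈ Finset.Icc (ρ + D) (t - 1), ‖Z (τ - i)‖ ^ 2 ≤
      K * blockNorm D Z ρ ^ 2 := by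
    intro i hi
    rw [Finset.mem_range] at hi
    refine le_trans ?_ (h Z hZ ρ t)
    rw [← Finset.sum_image (f := fun s => ‖Z s‖ ^ 2) (g := fun τ : ℤ => τ - i)
      fun x _ y _ hxy => by simpa using hxy]
    refine Finset.sum_le_sum_of_subset_of_nonneg ?_ fun _ _ _ => by positivity
    intro s hs
    simp only [Finset.mem_image, Finset.mem_Icc] at hs ⊢
    omega
  calc _ ≤ K * (D * ∑ i ∈ Finset.range D, K * blockNorm D Z ρ ^ 2) := by
        gcongr with i hi
        exact h3 i hi
    _ = _ := by
        rw [Finset.sum_const, Finset.card_range, nsmul_eq_mul]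
        ring

end Deterministic

end FAR

namespace FAR

/-! ### The `L²` pairing as an operator on `H` -/

section Space

variable {H : Type u} [NormedAddCommGroup H] [InnerProductSpace ℝ H] [RKHS ℝ H I ℝ]

lemma SubsetL2.integrable_mul (hL : SubsetL2 H) (f g : H) :
    Integrable (fun s : I => f s * g s) :=
  MemLp.integrable_mul (hL f) (hL g)

lemma SubsetL2.integrable_sq (hL : SubsetL2 H) (f : H) :
    Integrable (fun s : I => f s ^ 2) := by
  simpa only [sq] using hL.integrable_mul f f

/-- `T` is the operator of the `L²` inner product: `⟨g, T f⟩ = ∫ g f`. -/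
structure IsL2Op (T : H →L[ℝ] H) : Prop where
  norm_le : ‖T‖ ≤ 1
  inner_eq : ∀ g f : H, inner ℝ g (T f) = ∫ s : I, g s * f s

lemma l2NormSq_sub_le (hL : SubsetL2 H) (f g : H) :
    l2NormSq (f - g) ≤ 2 * l2NormSq f + 2 * l2NormSq g := by
  simp only [l2NormSq]
  rw [← integral_const_mul, ← integral_const_mul, ← integral_add
    ((hL.integrable_sq f).const_mul _) ((hL.integrable_sq g).const_mul _)]
  refine integral_mono (hL.integrable_sq _)
    (((hL.integrable_sq f).const_mul _).add ((hL.integrable_sq g).const_mul _)) fun s => ?_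
  simp only [RKHS.coe_sub, Pi.sub_apply]
  nlinarith [sq_nonneg (f s + g s)]

lemma IsL2Op.inner_comm {T : H →L[ℝ] H} (hT : IsL2Op T) (f g : H) : inner ℝ g (T f) = inner ℝ (T g) f := by
  rw [real_inner_comm f, hT.inner_eq, hT.inner_eq]
  simp only [mul_comm]

variable [CompleteSpace H]

lemma apply_eq_inner (f : H) (s : I) : f s = inner ℝ (RKHS.kerFun H s (1 : ℝ)) f := by
  rw [RKHS.kerFun_inner]
  simp

lemma sum_apply_eq {ι : Type*} (S : Finset ι) (f : ι → H) (s : I) :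
    (∑ i ∈ S, f i) s = ∑ i ∈ S, f i s := by
  simp only [apply_eq_inner, inner_sum]

lemma KernelBounded.abs_apply_le (hK : KernelBounded H) (f : H) (s : I) : |f s| ≤ ‖f‖ := by
  have h1 : ‖RKHS.kerFun H s (1 : ℝ)‖ ≤ 1 := by
    have h2 := hK s
    rw [repKernel, apply_eq_inner, real_inner_self_eq_norm_sq] at h2
    exact abs_le_of_sq_le_sq' (by simpa using h2) zero_le_one |>.2
  rw [apply_eq_inner]
  refine (abs_real_inner_le_norm _ _).trans ?_
  exact mul_le_of_le_one_left (norm_nonneg _) h1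

lemma KernelBounded.abs_integral_mul_le (hK : KernelBounded H) (f g : H) :
    |∫ s : I, f s * g s| ≤ ‖f‖ * ‖g‖ := by
  have := norm_integral_le_of_norm_le_const (μ := (volume : Measure I))
    (f := fun s : I => f s * g s) (C := ‖f‖ * ‖g‖) (ae_of_all _ fun s => by
      rw [norm_mul]
      exact mul_le_mul (hK.abs_apply_le f s) (hK.abs_apply_le g s) (norm_nonneg _) (norm_nonneg _))
  simpa using this

/-- The pairing is a bilinear form bounded by `1`, since point evaluations have norm at most `1`;
Riesz representation gives `T`. -/
lemma exists_isL2Op (hL : SubsetL2 H) (hK : KernelBounded H) : ∃ T : H →L[ℝ] H, IsL2Op T := by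
  let b : H →ₗ[ℝ] H →ₗ[ℝ] ℝ := LinearMap.mk₂ ℝ (fun f g : H => ∫ s : I, f s * g s)
    (fun f f' g => by
      rw [← integral_add (hL.integrable_mul _ _) (hL.integrable_mul _ _)]
      simp [add_mul])
    (fun c f g => by
      rw [smul_eq_mul, ← integral_const_mul]
      simp [mul_assoc])
    (fun f g g' => by
      rw [← integral_add (hL.integrable_mul _ _) (hL.integrable_mul _ _)]
      simp [mul_add])
    (fun c f g => by
      rw [smul_eq_mul, ← integral_const_mul]
      simp [mul_left_comm])
  let b' : H →L[ℝ] H →L[ℝ] ℝ := b.mkContinuous₂ 1 fun f g => by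
    simpa [b] using hK.abs_integral_mul_le f g
  let T : H →L[ℝ] H := InnerProductSpace.continuousLinearMapOfBilin (𝕜 := ℝ) b'
  have hT : ∀ g f : H, inner ℝ g (T f) = ∫ s : I, g s * f s := fun g f => by
    rw [real_inner_comm]
    have := InnerProductSpace.continuousLinearMapOfBilin_apply (𝕜 := ℝ) b' f g
    rw [this]
    simp only [mul_comm (g _)]
    rfl
  refine ⟨T, ContinuousLinearMap.opNorm_le_bound _ zero_le_one fun f => ?_, hT⟩
  have h1 : ‖T f‖ ^ 2 ≤ ‖T f‖ * ‖f‖ := by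
    rw [← real_inner_self_eq_norm_sq, hT]
    exact (le_abs_self _).trans (hK.abs_integral_mul_le _ _)
  rcases (norm_nonneg (T f)).eq_or_lt with h | h
  · rw [← h]
    positivity
  · nlinarith

lemma l2NormSq_le (hK : KernelBounded H) (f : H) : l2NormSq f ≤ ‖f‖ ^ 2 := by
  rw [sq ‖f‖, l2NormSq]
  simp only [sq]
  exact (le_abs_self _).trans (hK.abs_integral_mul_le f f)

variable {T : H →L[ℝ] H}

/-- `‖T f‖² = ∫ (T f) f` is at most half the sum of the two squared `L²` norms, and that of `T f` is
absorbed because `L²` norms are dominated by `H` norms. -/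
lemma IsL2Op.norm_sq_le (hT : IsL2Op T) (hL : SubsetL2 H) (hK : KernelBounded H) (f : H) :
    ‖T f‖ ^ 2 ≤ l2NormSq f := by
  have h1 : ‖T f‖ ^ 2 = ∫ s : I, T f s * f s := by
    rw [← real_inner_self_eq_norm_sq, hT.inner_eq]
  have h2 : 2 * ∫ s : I, T f s * f s ≤ l2NormSq (T f) + l2NormSq f := by
    simp only [l2NormSq]
    rw [← integral_const_mul, ← integral_add (hL.integrable_sq _) (hL.integrable_sq _)]
    refine integral_mono ((hL.integrable_mul _ _).const_mul _)
      ((hL.integrable_sq _).add (hL.integrable_sq _)) fun s => ?_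
    simp only
    nlinarith [sq_nonneg (T f s - f s)]
  have h3 := l2NormSq_le hK (T f)
  linarith

/-- The integral operator with kernel `A (r, s)` is `A ∘ T`. -/
lemma IsL2Op.integral_bivariate (hT : IsL2Op T) (A : H →L[ℝ] H) (f : H) (r : I) :
    ∫ s : I, bivariate A r s * f s = A (T f) r := by
  rw [apply_eq_inner (A (T f)), ← ContinuousLinearMap.adjoint_inner_left, hT.inner_eq]
  refine integral_congr_ae (ae_of_all _ fun s => ?_)
  simp only
  congr 1
  rw [bivariate, apply_eq_inner, apply_eq_inner (ContinuousLinearMap.adjoint A _),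
    ← ContinuousLinearMap.adjoint_inner_left, real_inner_comm]

lemma IsL2Op.solvesFAR_iff [MeasurableSpace H] {Ω : Type v} [MeasurableSpace Ω] {P : Measure Ω}
    (hT : IsL2Op T) {D : ℕ} (A : Fin D → H →L[ℝ] H) (ε X : ℤ → Ω → H) :
    SolvesFAR A ε X P ↔ (∀ t, Measurable (X t)) ∧ ∀ t, ∀ᵐ ω ∂P,
      X t ω = lagOp (fun d => A d ∘L T) (fun s => X s ω) t + ε t ω := by
  have key : ∀ t ω, (∀ r : I, X t ω r =
      (∑ d : Fin D, ∫ s : I, bivariate (A d) r s * X (t - ((d : ℤ) + 1)) ω s) + ε t ω r) ↔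
      X t ω = lagOp (fun d => A d ∘L T) (fun s => X s ω) t + ε t ω := by
    intro t ω
    simp only [hT.integral_bivariate, ← sum_apply_eq]
    constructor
    · intro h
      refine RKHS.ext fun r => ?_
      rw [h r, RKHS.coe_add]
      rfl
    · intro h r
      conv_lhs => rw [h, RKHS.coe_add]
      rfl
  constructor
  · rintro ⟨h1, h2⟩
    exact ⟨h1, fun t => (h2 t).mono fun ω h => (key t ω).1 h⟩
  · rintro ⟨h1, h2⟩
    exact ⟨h1, fun t => (h2 t).mono fun ω h => (key t ω).2 h⟩

end Space

end FAR

namespace FAR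

/-! ### Stationarity and uniqueness -/

section Stationarity

variable {Ω : Type v} [MeasurableSpace Ω] {P : Measure Ω}
  {H : Type u} [NormedAddCommGroup H] [InnerProductSpace ℝ H]
  {D : ℕ} {B : Fin D → H →L[ℝ] H} {γ : ℝ}

lemma iterate_lagOp_shift (B : Fin D → H →L[ℝ] H) (w : ℤ → H) (h : ℤ) (k : ℕ) (t : ℤ) :
    (lagOp B)^[k] (fun s => w (s + h)) t = (lagOp B)^[k] w (t + h) := by
  induction k generalizing t with
  | zero => rfl
  | succ k ih =>
    rw [Function.iterate_succ_apply', Function.iterate_succ_apply']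
    refine Finset.sum_congr rfl fun d _ => ?_
    rw [ih]
    rw [sub_add_eq_add_sub]

lemma neumann_shift (B : Fin D → H →L[ℝ] H) (w : ℤ → H) (h : ℤ) (t : ℤ) :
    neumann B (fun s => w (s + h)) t = neumann B w (t + h) := by
  simp only [neumann, iterate_lagOp_shift]

/-- Truncation of a random element at norm `C`. -/
noncomputable def truncate (C : ℝ) : H → H := (Metric.closedBall (0 : H) C).indicator id

lemma norm_truncate_le {C : ℝ} (hC : 0 ≤ C) (x : H) : ‖truncate C x‖ ≤ C := by
  by_cases h : x ∈ Metric.closedBall (0 : H) C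
  · rw [truncate, Set.indicator_of_mem h]
    simpa using h
  · rw [truncate, Set.indicator_of_notMem h]
    simpa using hC

lemma truncate_of_norm_le {C : ℝ} {x : H} (h : ‖x‖ ≤ C) : truncate C x = x := by
  rw [truncate, Set.indicator_of_mem (by simpa using h)]
  rfl

variable [MeasurableSpace H] [BorelSpace H]

lemma measurable_truncate (C : ℝ) : Measurable (truncate C : H → H) :=
  measurable_id.indicator measurableSet_closedBall

lemma IsIIDNoise.identDistrib_shift [IsProbabilityMeasure P] {ε : ℤ → Ω → H}
    (hε : IsIIDNoise ε P) (h : ℤ) :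
    IdentDistrib (fun ω t => ε (t + h) ω) (fun ω t => ε t ω) P P := by
  refine ⟨(measurable_pi_lambda _ fun t => hε.measurable _).aemeasurable,
    (measurable_pi_lambda _ fun t => hε.measurable _).aemeasurable, ?_⟩
  have hi : iIndepFun (fun t => ε (t + h)) P := hε.indep.precomp (add_left_injective h)
  rw [hi.map_fun_eq_infinitePi_map fun t => hε.measurable _,
    hε.indep.map_fun_eq_infinitePi_map hε.measurable]
  congr 1
  funext t
  exact ((hε.identDistrib (t + h)).map_eq).trans (hε.identDistrib t).map_eq.symm

/-- The noise is bounded only almost surely; truncation makes the bound hold everywhere, so the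
series converges on every path. -/
lemma IsIIDNoise.truncate {ε : ℤ → Ω → H} (hε : IsIIDNoise ε P) (C : ℝ) :
    IsIIDNoise (fun t ω => truncate C (ε t ω)) P where
  measurable t := (measurable_truncate C).comp (hε.measurable t)
  indep := hε.indep.comp (fun _ => FAR.truncate C) fun _ => measurable_truncate C
  identDistrib t := (hε.identDistrib t).comp (measurable_truncate C)

variable [SecondCountableTopology H]

lemma measurable_iterate_lagOp {α : Type*} [MeasurableSpace α] {e : ℤ → α → H}
    (he : ∀ t, Measurable (e t)) (k : ℕ) (t : ℤ) :
    Measurable fun a => (lagOp B)^[k] (fun s => e s a) t := by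
  induction k generalizing t with
  | zero => exact he t
  | succ k ih =>
    simp only [Function.iterate_succ_apply']
    exact Finset.measurable_fun_sum _ fun d _ => (B d).continuous.measurable.comp (ih _)

variable [CompleteSpace H]

lemma LagBound.measurable_neumann (hB : LagBound B γ) (hγ : 0 ≤ γ) (hγ1 : γ < 1)
    {α : Type*} [MeasurableSpace α] {e : ℤ → α → H} (he : ∀ t, Measurable (e t)) {C : ℝ}
    (hC : ∀ t a, ‖e t a‖ ≤ C) (t : ℤ) :
    Measurable fun a => neumann B (fun s => e s a) t := by
  refine measurable_of_tendsto_metrizable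
    (f := fun n a => ∑ k ∈ Finset.range n, (lagOp B)^[k] (fun s => e s a) t)
    (fun n => Finset.measurable_fun_sum _ fun k _ => measurable_iterate_lagOp he k t) ?_
  rw [tendsto_pi_nhds]
  exact fun a => (hB.hasSum_neumann hγ hγ1 (fun s => hC s a) t).tendsto_sum_nat

/-- The solution is one measurable, shift-equivariant map applied to the noise path, whose law is
shift-invariant. -/
lemma LagBound.strictlyStationary_neumann [IsProbabilityMeasure P] (hB : LagBound B γ)
    (hγ : 0 ≤ γ) (hγ1 : γ < 1) {ε : ℤ → Ω → H} (hε : IsIIDNoise ε P) {C : ℝ} (hC : 0 ≤ C) :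
    StrictlyStationary (fun t ω => neumann B (fun s => truncate C (ε s ω)) t) P := by
  intro h
  have hm : Measurable fun (w : ℤ → H) (t : ℤ) => neumann B (fun s => truncate C (w s)) t :=
    measurable_pi_lambda _ fun t => hB.measurable_neumann hγ hγ1
      (e := fun s (w : ℤ → H) => truncate C (w s))
      (fun s => (measurable_truncate C).comp (measurable_pi_apply s))
      (fun s w => norm_truncate_le hC _) t
  have := (hε.identDistrib_shift h).comp hm
  convert! this using 1
  funext ω t
  exact (neumann_shift B (fun s => FAR.truncate C (ε s ω)) h t).symm

lemma StrictlyStationary.weaklyStationary [IsProbabilityMeasure P] {X : ℤ → Ω → H}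
    (hX : StrictlyStationary X P) (hL : ∀ t, MemLp (X t) 2 P) : WeaklyStationary X P := by
  have hint : ∀ s h, ∫ ω, X (s + h) ω ∂P = ∫ ω, X s ω ∂P := fun s h =>
    ((hX h).comp (measurable_pi_apply s)).integral_eq
  have hinn : ∀ s h x, ∫ ω, inner ℝ (X (s + h) ω) x ∂P = ∫ ω, inner ℝ (X s ω) x ∂P :=
    fun s h x => ((hX h).comp
      (u := fun w : ℤ → H => (inner ℝ (w s) x : ℝ))
      ((measurable_pi_apply s).inner_const)).integral_eq
  refine ⟨hL, fun s t => ?_, fun h s t x y => ?_⟩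
  · rw [← hint t (s - t)]
    congr 2
    ring_nf
  · unfold covariance
    rw [hinn, hinn]
    exact ((hX h).comp (u := fun w : ℤ → H =>
      ((inner ℝ (w s) x : ℝ) - ∫ ω, inner ℝ (X s ω) x ∂P) *
        ((inner ℝ (w t) y : ℝ) - ∫ ω, inner ℝ (X t ω) y ∂P))
      ((((measurable_pi_apply s).inner_const).sub_const _).mul
        (((measurable_pi_apply t).inner_const).sub_const _))).integral_eq

lemma countable_of_hilbertBasis {ι : Type*} (b : HilbertBasis ι ℝ H) : Countable ι := by
  rw [← Set.countable_univ_iff]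
  refine Set.PairwiseDisjoint.countable_of_isOpen (s := fun i => Metric.ball (b i) (1 / 2)) ?_
    (fun i _ => Metric.isOpen_ball) fun i _ => Metric.nonempty_ball.2 (by norm_num)
  intro i _ j _ hij
  refine Metric.ball_disjoint_ball ?_
  have h1 : ‖b i - b j‖ ^ 2 = 2 := by
    rw [norm_sub_sq_real, b.orthonormal.1 i, b.orthonormal.1 j, b.orthonormal.2 hij]
    norm_num
  rw [dist_eq_norm]
  nlinarith [norm_nonneg (b i - b j)]

/-- Weak stationarity only concerns scalar covariances; summing second moments of coordinates in a
countable Hilbert basis recovers the norm. -/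
lemma WeaklyStationary.lintegral_norm_sq_eq [IsProbabilityMeasure P] {Y : ℤ → Ω → H}
    (hY : WeaklyStationary Y P) (t : ℤ) :
    ∫⁻ ω, ENNReal.ofReal (‖Y t ω‖ ^ 2) ∂P = ∫⁻ ω, ENNReal.ofReal (‖Y 0 ω‖ ^ 2) ∂P := by
  obtain ⟨w, b, -⟩ := exists_hilbertBasis ℝ H
  have := countable_of_hilbertBasis b
  have hin : ∀ t (x : H), MemLp (fun ω => (inner ℝ (Y t ω) x : ℝ)) 2 P := fun t x =>
    (hY.memLp t).inner_const x
  have hexp : ∀ t, ∫⁻ ω, ENNReal.ofReal (‖Y t ω‖ ^ 2) ∂P =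
      ∑' i, ENNReal.ofReal (∫ ω, (inner ℝ (Y t ω) (b i) : ℝ) ^ 2 ∂P) := by
    intro t
    calc _ = ∫⁻ ω, ∑' i, ENNReal.ofReal ((inner ℝ (Y t ω) (b i) : ℝ) ^ 2) ∂P := by
          refine lintegral_congr fun ω => ?_
          have hs := b.hasSum_inner_mul_inner (Y t ω) (Y t ω)
          rw [real_inner_self_eq_norm_sq] at hs
          have hs' : HasSum (fun i => (inner ℝ (Y t ω) (b i) : ℝ) ^ 2) (‖Y t ω‖ ^ 2) := by
            refine hs.congr_fun fun i => ?_
            rw [real_inner_comm (Y t ω) (b i), sq]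
          rw [← hs'.tsum_eq, ENNReal.ofReal_tsum_of_nonneg (fun _ => sq_nonneg _) hs'.summable]
      _ = _ := by
          rw [lintegral_tsum fun i =>
            ((hin t (b i)).integrable_sq.aestronglyMeasurable.aemeasurable.ennreal_ofReal)]
          refine tsum_congr fun i => ?_
          rw [ofReal_integral_eq_lintegral_ofReal (hin t (b i)).integrable_sq
            (ae_of_all _ fun _ => sq_nonneg _)]
  rw [hexp, hexp]
  refine tsum_congr fun i => ?_
  congr 1
  have hsq : ∀ t, ∫ ω, (inner ℝ (Y t ω) (b i) : ℝ) ^ 2 ∂P =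
      covariance (fun ω => inner ℝ (Y t ω) (b i)) (fun ω => inner ℝ (Y t ω) (b i)) P +
        (inner ℝ (b i) (∫ ω, Y t ω ∂P)) ^ 2 := by
    intro t
    rw [covariance_eq_sub (hin t _) (hin t _),
      ← integral_inner ((hY.memLp t).integrable (by norm_num)) (b i)]
    simp only [Pi.mul_apply, real_inner_comm (b i), sq]
    ring
  rw [hsq, hsq, hY.mean t 0]
  congr 1
  simpa using hY.cov t 0 0 (b i) (b i)

/-- Boundedness in probability, uniformly in time. -/
def BoundedInProbability (Y : ℤ → Ω → H) (P : Measure Ω) : Prop :=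
  ∀ η : ENNReal, η ≠ 0 → ∃ R : ℝ, 0 ≤ R ∧ ∀ t, P {ω | R < ‖Y t ω‖} ≤ η

lemma StrictlyStationary.boundedInProbability [IsProbabilityMeasure P] {Y : ℤ → Ω → H}
    (hY : StrictlyStationary Y P) (hm : ∀ t, Measurable (Y t)) : BoundedInProbability Y P := by
  intro η hη
  have hlim := tendsto_measure_iInter_atTop (μ := P) (s := fun n : ℕ => {ω | (n : ℝ) < ‖Y 0 ω‖})
    (fun n => (measurableSet_lt measurable_const (hm 0).norm).nullMeasurableSet)
    (fun n m hnm ω (hω : (m : ℝ) < _) => lt_of_le_of_lt (by exact_mod_cast hnm) hω)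
    ⟨0, measure_ne_top _ _⟩
  have hempty : ⋂ n : ℕ, {ω | (n : ℝ) < ‖Y 0 ω‖} = ∅ := by
    ext ω
    simp only [Set.mem_iInter, Set.mem_ofPred_eq, Set.mem_empty_iff_false, iff_false, not_forall,
      not_lt]
    exact exists_nat_ge _
  rw [hempty, measure_empty] at hlim
  obtain ⟨n, hn⟩ := (hlim.eventually (gt_mem_nhds (pos_iff_ne_zero.2 hη))).exists
  refine ⟨n, by positivity, fun t => ?_⟩
  have h1 := ((hY t).comp (measurable_pi_apply 0)).measure_mem_eq
    (s := {x : H | (n : ℝ) < ‖x‖}) (measurableSet_lt measurable_const measurable_norm)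
  have h2 : P {ω | (n : ℝ) < ‖Y t ω‖} = P {ω | (n : ℝ) < ‖Y 0 ω‖} := by
    simpa [Set.preimage, Function.comp_def] using h1
  rw [h2]
  exact hn.le

lemma WeaklyStationary.boundedInProbability [IsProbabilityMeasure P] {Y : ℤ → Ω → H}
    (hY : WeaklyStationary Y P) (hm : ∀ t, Measurable (Y t)) : BoundedInProbability Y P := by
  intro η hη
  set M := ∫⁻ ω, ENNReal.ofReal (‖Y 0 ω‖ ^ 2) ∂P with hM
  have hMtop : M ≠ ⊤ := by
    rw [hM, ← ofReal_integral_eq_lintegral_ofReal (hY.memLp 0).integrable_norm_pow'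
      (ae_of_all _ fun _ => sq_nonneg _)]
    exact ENNReal.ofReal_ne_top
  have hlim : Filter.Tendsto (fun n : ℕ => M / (n : ENNReal)) Filter.atTop (nhds 0) := by
    have := ENNReal.Tendsto.const_mul ENNReal.tendsto_inv_nat_nhds_zero (a := M) (Or.inr hMtop)
    simpa [div_eq_mul_inv] using this
  obtain ⟨n, hn, hn1⟩ := ((hlim.eventually (gt_mem_nhds (pos_iff_ne_zero.2 hη))).and
    (Filter.eventually_ge_atTop 1)).exists
  refine ⟨n, by positivity, fun t => ?_⟩
  refine (measure_mono fun ω (hω : (n : ℝ) < ‖Y t ω‖) => ?_).trans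
    ((meas_ge_le_lintegral_div (μ := P) (f := fun ω => ENNReal.ofReal (‖Y t ω‖ ^ 2))
      (((hm t).norm.pow_const 2).ennreal_ofReal.aemeasurable) (ε := n)
      (by exact_mod_cast (by omega : n ≠ 0)) (ENNReal.natCast_ne_top n)).trans ?_)
  · simp only [Set.mem_ofPred_eq]
    rw [← ENNReal.ofReal_natCast]
    refine ENNReal.ofReal_le_ofReal ?_
    have : (1 : ℝ) ≤ n := by exact_mod_cast hn1
    nlinarith
  · rw [hY.lintegral_norm_sq_eq t]
    exact hn.le

/-- A solution of the homogeneous equation that is bounded in probability vanishes. -/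
lemma LagBound.ae_eq_zero_of_boundedInProbability (hB : LagBound B γ)
    (hγ : 0 ≤ γ) (hγ1 : γ < 1) {Z : ℤ → Ω → H} (hZ : BoundedInProbability Z P)
    (heq : ∀ t, ∀ᵐ ω ∂P, Z t ω = lagOp B (fun s => Z s ω) t) (t : ℤ) : ∀ᵐ ω ∂P, Z t ω = 0 := by
  obtain ⟨K, hK, hbound⟩ := hB.exists_mul_norm_sq_le hγ hγ1
  have hnull : P {ω | ¬ ∀ t, Z t ω = lagOp B (fun s => Z s ω) t} = 0 :=
    ae_iff.1 (ae_all_iff.2 heq)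
  have hsmall : ∀ δ : ℝ, 0 < δ → P {ω | δ ≤ ‖Z t ω‖} = 0 := by
    intro δ hδ
    have hle : ∀ η : ENNReal, η ≠ 0 → P {ω | δ ≤ ‖Z t ω‖} ≤ D * η := by
      intro η hη
      obtain ⟨R, hR, hRt⟩ := hZ η hη
      -- For this `n`, `‖Z t‖ ≥ δ` is incompatible with all `D` past values being at most `R`.
      obtain ⟨n, hn⟩ := exists_nat_gt (K * (D * R) ^ 2 / δ ^ 2)
      rw [div_lt_iff₀ (by positivity)] at hn
      calc P {ω | δ ≤ ‖Z t ω‖} ≤ P ({ω | ¬ ∀ t, Z t ω = lagOp B (fun s => Z s ω) t} ∪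
            ⋃ i ∈ Finset.range D, {ω | R < ‖Z (t - D - n - (i : ℕ)) ω‖}) := by
            refine measure_mono fun ω (hω : δ ≤ _) => ?_
            by_contra hcon
            simp only [Set.mem_union, Set.mem_iUnion, Set.mem_ofPred_eq, not_or, not_not,
              not_exists, not_lt] at hcon
            have h1 := hbound (fun s => Z s ω) hcon.1 t n
            have h2 : blockNorm D (fun s => Z s ω) (t - D - n) ≤ D * R := by
              refine (Finset.sum_le_sum fun i hi => hcon.2 i hi).trans_eq ?_
              rw [Finset.sum_const, Finset.card_range, nsmul_eq_mul]
            have h3 : (n : ℝ) * δ ^ 2 ≤ n * ‖Z t ω‖ ^ 2 := by gcongr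
            have h4 : K * blockNorm D (fun s => Z s ω) (t - D - n) ^ 2 ≤ K * (D * R) ^ 2 := by
              have := blockNorm_nonneg D (fun s => Z s ω) (t - D - n)
              gcongr
            linarith
        _ ≤ 0 + ∑ i ∈ Finset.range D, η := by
            refine (measure_union_le _ _).trans ?_
            rw [hnull]
            gcongr
            exact (measure_biUnion_finset_le _ _).trans (Finset.sum_le_sum fun i _ => hRt _)
        _ = D * η := by simp
    have hlim : Filter.Tendsto (fun n : ℕ => (D : ENNReal) * (n : ENNReal)⁻¹) Filter.atTop
        (nhds 0) := by
      simpa using ENNReal.Tendsto.const_mul ENNReal.tendsto_inv_nat_nhds_zero (a := (D : ENNReal))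
        (Or.inr (ENNReal.natCast_ne_top D))
    exact le_antisymm (ge_of_tendsto' hlim fun n =>
      hle _ (ENNReal.inv_ne_zero.2 (ENNReal.natCast_ne_top n))) bot_le
  have hall : ∀ᵐ ω ∂P, ∀ n : ℕ, ‖Z t ω‖ < 1 / ((n : ℝ) + 1) := by
    refine ae_all_iff.2 fun n => ?_
    rw [ae_iff]
    simpa only [not_lt] using hsmall (1 / ((n : ℝ) + 1)) (by positivity)
  filter_upwards [hall] with ω hω
  rw [← norm_eq_zero]
  refine le_antisymm (ge_of_tendsto' tendsto_one_div_add_atTop_nhds_zero_nat fun n => (hω n).le)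
    (norm_nonneg _)

lemma BoundedInProbability.sub_of_norm_le {X Y : ℤ → Ω → H} (hY : BoundedInProbability Y P)
    {M : ℝ} (hX : ∀ t ω, ‖X t ω‖ ≤ M) :
    BoundedInProbability (fun t ω => Y t ω - X t ω) P := by
  intro η hη
  obtain ⟨R, hR, h⟩ := hY η hη
  refine ⟨R + |M|, by positivity, fun t => (measure_mono fun ω hω => ?_).trans (h t)⟩
  simp only [Set.mem_ofPred_eq] at hω ⊢
  have h1 := norm_sub_le (Y t ω) (X t ω)
  have h2 := (hX t ω).trans (le_abs_self M)
  linarith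

end Stationarity

end FAR

namespace FAR

/-! ### Orthogonality of the noise to the past -/

section Orthogonality

variable {Ω : Type v} [MeasurableSpace Ω] {P : Measure Ω} [IsProbabilityMeasure P]

/-- Pythagoras, with the nonnegative term `E g²` dropped. -/
lemma sum_integral_sq_le {ι : Type*} (S : Finset ι) {f : ι → Ω → ℝ} {g : Ω → ℝ}
    (hf : ∀ i ∈ S, MemLp (f i) 2 P) (hg : MemLp g 2 P)
    (hff : ∀ i ∈ S, ∀ j ∈ S, i ≠ j → ∫ ω, f i ω * f j ω ∂P = 0)
    (hfg : ∀ i ∈ S, ∫ ω, f i ω * g ω ∂P = 0) :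
    ∑ i ∈ S, ∫ ω, f i ω ^ 2 ∂P ≤ ∫ ω, (∑ i ∈ S, f i ω + g ω) ^ 2 ∂P := by
  classical
  have hexp : ∀ ω, (∑ i ∈ S, f i ω + g ω) ^ 2 =
      (∑ i ∈ S, ∑ j ∈ S, f i ω * f j ω + 2 * ∑ i ∈ S, f i ω * g ω) + g ω ^ 2 := by
    intro ω
    rw [← Finset.sum_mul_sum, ← Finset.sum_mul]
    ring
  have h1 : ∀ i ∈ S, ∀ j ∈ S, Integrable (fun ω => f i ω * f j ω) P := fun i hi j hj =>
    (hf i hi).integrable_mul (hf j hj)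
  have h2 : ∀ i ∈ S, Integrable (fun ω => f i ω * g ω) P := fun i hi =>
    (hf i hi).integrable_mul hg
  have h3 : Integrable (fun ω => ∑ i ∈ S, ∑ j ∈ S, f i ω * f j ω) P :=
    integrable_finsetSum _ fun i hi => integrable_finsetSum _ fun j hj => h1 i hi j hj
  have h4 : Integrable (fun ω => 2 * ∑ i ∈ S, f i ω * g ω) P :=
    (integrable_finsetSum _ h2).const_mul 2
  have h34 : Integrable
      (fun ω => ∑ i ∈ S, ∑ j ∈ S, f i ω * f j ω + 2 * ∑ i ∈ S, f i ω * g ω) P := h3.add h4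
  simp only [hexp]
  rw [integral_add h34 hg.integrable_sq, integral_add h3 h4, integral_const_mul,
    integral_finsetSum _ h2, Finset.sum_eq_zero hfg, integral_finsetSum _ fun i hi =>
      integrable_finsetSum _ fun j hj => h1 i hi j hj]
  have h5 : ∑ i ∈ S, ∫ ω, ∑ j ∈ S, f i ω * f j ω ∂P = ∑ i ∈ S, ∫ ω, f i ω ^ 2 ∂P := by
    refine Finset.sum_congr rfl fun i hi => ?_
    rw [integral_finsetSum _ fun j hj => h1 i hi j hj,
      Finset.sum_eq_single_of_mem i hi fun j hj hji => hff i hi j hj hji.symm]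
    simp only [sq]
  rw [h5]
  have h6 : 0 ≤ ∫ ω, g ω ^ 2 ∂P := integral_nonneg fun ω => sq_nonneg _
  linarith

variable {H : Type u} [NormedAddCommGroup H] [InnerProductSpace ℝ H] [CompleteSpace H]
  [MeasurableSpace H] [BorelSpace H] [SecondCountableTopology H]
  {D : ℕ} {B : Fin D → H →L[ℝ] H} {γ : ℝ}

lemma memLp_inner_of_bound {Y : Ω → H} (hY : Measurable Y) {M : ℝ} (hM : ∀ ω, ‖Y ω‖ ≤ M) (a : H) :
    MemLp (fun ω => (inner ℝ a (Y ω) : ℝ)) 2 P :=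
  (MemLp.of_bound hY.aestronglyMeasurable M (ae_of_all _ hM)).const_inner a

lemma integral_inner_eq_zero [RKHS ℝ H I ℝ] {Y : Ω → H} (hY : Integrable Y P)
    (h0 : ∀ s : I, ∫ ω, Y ω s ∂P = 0) (a : H) : ∫ ω, (inner ℝ a (Y ω) : ℝ) ∂P = 0 := by
  have h1 : ∫ ω, Y ω ∂P = 0 := by
    refine RKHS.ext fun s => ?_
    rw [apply_eq_inner, ← integral_inner hY]
    simp only [← apply_eq_inner, h0]
    simp
  rw [integral_inner hY, h1, inner_zero_right]

variable {e : ℤ → Ω → H}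

lemma IsIIDNoise.integral_inner_mul_inner (he : IsIIDNoise e P)
    (h0 : ∀ p a, ∫ ω, (inner ℝ a (e p ω) : ℝ) ∂P = 0) {p q : ℤ} (hpq : p ≠ q) (a b : H) :
    ∫ ω, (inner ℝ a (e p ω) : ℝ) * inner ℝ b (e q ω) ∂P = 0 := by
  have hi : IndepFun (fun ω => (inner ℝ a (e p ω) : ℝ)) (fun ω => (inner ℝ b (e q ω) : ℝ)) P :=
    (he.indep.indepFun hpq).comp (φ := fun x : H => (inner ℝ a x : ℝ))
      (ψ := fun x : H => (inner ℝ b x : ℝ)) (by fun_prop) (by fun_prop)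
  rw [hi.integral_fun_mul_eq_mul_integral
    ((he.measurable p).const_inner.aestronglyMeasurable)
    ((he.measurable q).const_inner.aestronglyMeasurable), h0, zero_mul]

/-- Each iteration moves further into the past, and adjoints shift the operators onto the test
vector, so pairwise independence suffices. -/
lemma IsIIDNoise.integral_inner_mul_inner_iterate (he : IsIIDNoise e P)
    (h0 : ∀ p a, ∫ ω, (inner ℝ a (e p ω) : ℝ) ∂P = 0) (hB : LagBound B γ) (hγ : 0 ≤ γ)
    {C : ℝ} (hC : ∀ t ω, ‖e t ω‖ ≤ C) (k : ℕ) {p q : ℤ} (hpq : q < p) (a b : H) :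
    ∫ ω, (inner ℝ a (e p ω) : ℝ) *
      inner ℝ b ((lagOp B)^[k] (fun s => e s ω) q) ∂P = 0 := by
  induction k generalizing q b with
  | zero => exact he.integral_inner_mul_inner h0 (by omega) a b
  | succ k ih =>
    simp only [Function.iterate_succ_apply', lagOp, inner_sum, Finset.mul_sum]
    rw [integral_finsetSum]
    · refine Finset.sum_eq_zero fun d _ => ?_
      simp only [← ContinuousLinearMap.adjoint_inner_left]
      exact ih (by omega) _
    · intro d _
      simp only [← ContinuousLinearMap.adjoint_inner_left]
      exact (memLp_inner_of_bound (he.measurable p) (hC p) a).integrable_mul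
        (memLp_inner_of_bound (measurable_iterate_lagOp he.measurable k _)
          (fun ω => hB.norm_iterate_le hγ (fun t => hC t ω) k _) _)

lemma IsIIDNoise.integral_inner_mul_inner_neumann (he : IsIIDNoise e P)
    (h0 : ∀ p a, ∫ ω, (inner ℝ a (e p ω) : ℝ) ∂P = 0) (hB : LagBound B γ) (hγ : 0 ≤ γ)
    (hγ1 : γ < 1) {C : ℝ} (hC : ∀ t ω, ‖e t ω‖ ≤ C) {p q : ℤ} (hpq : q < p) (a b : H) :
    ∫ ω, (inner ℝ a (e p ω) : ℝ) * inner ℝ b (neumann B (fun s => e s ω) q) ∂P = 0 := by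
  have hb : ∀ k ω, ‖(inner ℝ a (e p ω) : ℝ) * inner ℝ b ((lagOp B)^[k] (fun s => e s ω) q)‖ ≤
      (‖a‖ * C) * (‖b‖ * (C * (γ ^ k * ((k * D : ℕ) + 1)))) := by
    intro k ω
    have hC0 : 0 ≤ C := (norm_nonneg _).trans (hC p ω)
    rw [norm_mul]
    refine mul_le_mul ((norm_inner_le_norm _ _).trans ?_) ((norm_inner_le_norm _ _).trans ?_)
      (norm_nonneg _) (by positivity)
    · gcongr
      exact hC p ω
    · gcongr
      exact hB.norm_iterate_le hγ (fun t => hC t ω) k q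
  have hsum := hasSum_integral_of_dominated_convergence (μ := P)
    (F := fun k ω => (inner ℝ a (e p ω) : ℝ) * inner ℝ b ((lagOp B)^[k] (fun s => e s ω) q))
    (f := fun ω => (inner ℝ a (e p ω) : ℝ) * inner ℝ b (neumann B (fun s => e s ω) q))
    (fun k _ => (‖a‖ * C) * (‖b‖ * (C * (γ ^ k * ((k * D : ℕ) + 1)))))
    (fun k => ((he.measurable p).const_inner.mul
      (measurable_iterate_lagOp he.measurable k q).const_inner).aestronglyMeasurable)
    (fun k => ae_of_all _ (hb k))
    (ae_of_all _ fun _ => (((summable_geometric_mul_linear hγ hγ1 D).mul_left C).mul_left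
      ‖b‖).mul_left (‖a‖ * C))
    (integrable_const _)
    (ae_of_all _ fun ω => ((hB.hasSum_neumann hγ hγ1 (fun t => hC t ω) q).mapL
      (innerSL ℝ b)).mul_left _)
  simp only [he.integral_inner_mul_inner_iterate h0 hB hγ hC _ hpq] at hsum
  exact hsum.unique hasSum_zero

end Orthogonality

/-! ### Dual recursion and the restricted eigenvalue bound -/

section RestrictedEigenvalue

variable {H : Type u} [NormedAddCommGroup H] [InnerProductSpace ℝ H] {D : ℕ}

/-- Extension by zero of `v_1, …, v_D` to a two-sided sequence. -/
noncomputable def extendByZero (v : Fin D → H) (j : ℤ) : H :=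
  ∑ d : Fin D, if j = (d : ℤ) + 1 then v d else 0

lemma extendByZero_apply (v : Fin D → H) (d : Fin D) : extendByZero v ((d : ℤ) + 1) = v d := by
  rw [extendByZero, Finset.sum_eq_single_of_mem d (Finset.mem_univ _)]
  · simp
  · intro d' _ hd'
    rw [if_neg]
    intro h
    exact hd' (Fin.ext (by omega))

lemma extendByZero_eq_zero (v : Fin D → H) : ∀ j < 1, extendByZero v j = 0 := fun j hj =>
  Finset.sum_eq_zero fun d _ => if_neg (by omega)

lemma norm_extendByZero_le (v : Fin D → H) (j : ℤ) : ‖extendByZero v j‖ ≤ ∑ d, ‖v d‖ := by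
  refine (norm_sum_le _ _).trans (Finset.sum_le_sum fun d _ => ?_)
  split_ifs <;> simp

lemma sum_fin_eq_sum_Icc {M : Type*} [AddCommMonoid M] (D : ℕ) (F : ℤ → M) :
    ∑ d : Fin D, F ((d : ℤ) + 1) = ∑ j ∈ Finset.Icc (1 : ℤ) D, F j := by
  refine Finset.sum_bij (fun d _ => (d : ℤ) + 1) (fun d _ => ?_) (fun d _ d' _ h => ?_)
    (fun j hj => ?_) fun _ _ => rfl
  · rw [Finset.mem_Icc]
    have := d.2
    omega
  · exact Fin.ext (by omega)
  · rw [Finset.mem_Icc] at hj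
    exact ⟨⟨(j - 1).toNat, by omega⟩, Finset.mem_univ _, by simp only; omega⟩

/-- Shifting a sequence that vanishes before time `1` out of the window `[1, D]`. -/
lemma sum_Icc_sub_sum_shift {F : ℤ → ℝ} (hF : ∀ t < 1, F t = 0) {D : ℕ} {n : ℤ} (h0 : 0 ≤ n) :
    ∑ j ∈ Finset.Icc (1 : ℤ) D, F j - ∑ j ∈ Finset.Icc (1 : ℤ) D, F (j - n) =
      ∑ j ∈ Finset.Icc (1 : ℤ) D, if j ≤ D - n then 0 else F j := by
  have h1 : ∑ j ∈ Finset.Icc (1 : ℤ) D, F (j - n) =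
      ∑ j ∈ Finset.Icc (1 : ℤ) D, if j ≤ D - n then F j else 0 := by
    have h2 := sum_shift_eq (a := 1) (b := D - n) (c := D) h0 (by omega)
      (fun j => if j ≤ D - n then F j else 0) fun t ht => by
        split_ifs with h
        · refine hF t ?_
          rw [Finset.mem_Icc] at ht
          omega
        · rfl
    calc _ = ∑ j ∈ Finset.Icc (1 : ℤ) D, if j - n ≤ D - n then F (j - n) else 0 := by
          refine Finset.sum_congr rfl fun j hj => ?_
          rw [Finset.mem_Icc] at hj
          rw [if_pos (by omega)]
      _ = ∑ j ∈ Finset.Icc (1 : ℤ) (D - n), if j ≤ D - n then F j else 0 := h2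
      _ = _ := Finset.sum_subset (Finset.Icc_subset_Icc le_rfl (by omega)) fun j hj hj' => by
          rw [Finset.mem_Icc] at hj hj'
          rw [if_neg (by omega)]
  rw [h1, ← Finset.sum_sub_distrib]
  refine Finset.sum_congr rfl fun j _ => ?_
  split_ifs <;> simp

variable [CompleteSpace H] [RKHS ℝ H I ℝ] {T : H →L[ℝ] H} {A : Fin D → H →L[ℝ] H} {γ : ℝ}

/-- Rewriting a linear functional of `X_{t-1}, …, X_{t-D}` through the noise at these times and a
remainder in the strict past. -/
lemma IsL2Op.sum_inner_eq (hT : IsL2Op T) {u v x e : ℤ → H} {t : ℤ}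
    (hx : ∀ s, x s = lagOp (fun d => A d ∘L T) x s + e s) (hu0 : ∀ j < 1, u j = 0)
    (hu : ∀ j, u j = lagOp (fun d => ContinuousLinearMap.adjoint (A d) ∘L T) u j + v j) :
    ∑ j ∈ Finset.Icc (1 : ℤ) D, (inner ℝ (T (v j)) (x (t - j)) : ℝ) =
      ∑ j ∈ Finset.Icc (1 : ℤ) D, (inner ℝ (T (u j)) (e (t - j)) : ℝ) +
        ∑ d : Fin D, ∑ j ∈ Finset.Icc (1 : ℤ) D, if j ≤ D - ((d : ℤ) + 1) then 0 else
          (inner ℝ (T (u j)) (A d (T (x (t - j - ((d : ℤ) + 1))))) : ℝ) := by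
  have hv : ∀ j, (inner ℝ (T (v j)) (x (t - j)) : ℝ) = inner ℝ (T (u j)) (x (t - j)) -
      ∑ d : Fin D, inner ℝ (T (u (j - ((d : ℤ) + 1)))) (A d (T (x (t - j)))) := by
    intro j
    have h1 : v j = u j - lagOp (fun d => ContinuousLinearMap.adjoint (A d) ∘L T) u j :=
      eq_sub_of_add_eq' (hu j).symm
    rw [h1, map_sub, inner_sub_left, lagOp, map_sum, sum_inner]
    congr 1
    refine Finset.sum_congr rfl fun d _ => ?_
    rw [← hT.inner_comm]
    simp only [ContinuousLinearMap.comp_apply, ContinuousLinearMap.adjoint_inner_left]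
  have hxe : ∀ j, (inner ℝ (T (u j)) (x (t - j)) : ℝ) =
      ∑ d : Fin D, inner ℝ (T (u j)) (A d (T (x (t - j - ((d : ℤ) + 1))))) +
        inner ℝ (T (u j)) (e (t - j)) := by
    intro j
    conv_lhs => rw [hx (t - j), inner_add_right, lagOp, inner_sum]
    rfl
  -- The double sums from the recursions for `u` and `x` are shifts of each other; what survives has
  -- `j + (d + 1) > D`.
  have hshift : ∀ d : Fin D, _ := fun d => sum_Icc_sub_sum_shift (D := D) (n := (d : ℤ) + 1)
    (F := fun j => (inner ℝ (T (u j)) (A d (T (x (t - j - ((d : ℤ) + 1))))) : ℝ))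
    (fun j hj => by simp [hu0 j hj]) (by omega)
  simp only [hv, hxe, ← hshift, Finset.sum_sub_distrib, Finset.sum_add_distrib]
  rw [Finset.sum_comm (s := Finset.Icc (1 : ℤ) D), Finset.sum_comm (s := Finset.Icc (1 : ℤ) D)]
  have : ∀ (j : ℤ) (d : Fin D), t - (j - ((d : ℤ) + 1)) - ((d : ℤ) + 1) = t - j := fun j d => by
    ring
  simp only [this]
  ring

/-- From `v = u - L' u`: the constant is `2 + 2 γ² ≤ 4`. The passage to the `H` norm and back loses
nothing, as `‖f‖_{L²} ≤ ‖f‖_H` and `‖T f‖_H ≤ ‖f‖_{L²}`. -/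
lemma LagBound.sum_l2NormSq_le (hA : LagBound (fun d => ContinuousLinearMap.adjoint (A d)) γ)
    (hγ : 0 ≤ γ) (hγ1 : γ < 1) (hL : SubsetL2 H) (hK : KernelBounded H) (hT : IsL2Op T)
    {u v : ℤ → H} (hu0 : ∀ j < 1, u j = 0)
    (hu : ∀ j, u j = lagOp (fun d => ContinuousLinearMap.adjoint (A d) ∘L T) u j + v j) (b : ℤ) :
    ∑ j ∈ Finset.Icc 1 b, l2NormSq (v j) ≤ 4 * ∑ j ∈ Finset.Icc 1 b, l2NormSq (u j) := by
  have h1 := hA (fun j => T (u j)) 1 b fun j hj => by simp [hu0 j hj]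
  have h2 : ∑ j ∈ Finset.Icc 1 b, ‖T (u j)‖ ^ 2 ≤ ∑ j ∈ Finset.Icc 1 b, l2NormSq (u j) :=
    Finset.sum_le_sum fun j _ => hT.norm_sq_le hL hK _
  have h3 : ∀ j, l2NormSq (v j) ≤ 2 * l2NormSq (u j) +
      2 * ‖lagOp (fun d => ContinuousLinearMap.adjoint (A d)) (fun j => T (u j)) j‖ ^ 2 := by
    intro j
    rw [eq_sub_of_add_eq' (hu j).symm]
    refine (l2NormSq_sub_le hL _ _).trans ?_
    gcongr
    exact l2NormSq_le hK _
  have h4 : 0 ≤ ∑ j ∈ Finset.Icc 1 b, ‖T (u j)‖ ^ 2 := Finset.sum_nonneg fun _ _ => by positivity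
  calc _ ≤ ∑ j ∈ Finset.Icc 1 b, (2 * l2NormSq (u j) +
        2 * ‖lagOp (fun d => ContinuousLinearMap.adjoint (A d)) (fun j => T (u j)) j‖ ^ 2) :=
        Finset.sum_le_sum fun j _ => h3 j
    _ ≤ _ := by
        rw [Finset.sum_add_distrib, ← Finset.mul_sum, ← Finset.mul_sum]
        have h5 : γ ^ 2 ≤ 1 := pow_le_one₀ hγ hγ1.le
        nlinarith

variable {Ω : Type v} [MeasurableSpace Ω] {P : Measure Ω} [IsProbabilityMeasure P]
  [MeasurableSpace H] [BorelSpace H] [SecondCountableTopology H]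

theorem restrictedEigenvalue_neumann (hL : SubsetL2 H) (hK : KernelBounded H) (hT : IsL2Op T)
    (hγ : 0 ≤ γ) (hγ1 : γ < 1) (hA : LagBound A γ)
    (hA' : LagBound (fun d => ContinuousLinearMap.adjoint (A d)) γ)
    {e : ℤ → Ω → H} (he : IsIIDNoise e P)
    (h0 : ∀ p a, ∫ ω, (inner ℝ a (e p ω) : ℝ) ∂P = 0) {C : ℝ} (hC : ∀ t ω, ‖e t ω‖ ≤ C)
    {κ : ℝ} (hκ : 0 < κ) (hlow : NoiseLowerBound e P κ) :
    RestrictedEigenvalue D (fun t ω => neumann (fun d => A d ∘L T) (fun s => e s ω) t) P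
      (κ / 4) := by
  intro t v
  have hB := hA.comp hT.norm_le
  have hB' := hA'.comp hT.norm_le
  set X : ℤ → Ω → H := fun t ω => neumann (fun d => A d ∘L T) (fun s => e s ω) t with hX
  set v' : ℤ → H := extendByZero v
  set u : ℤ → H := neumann (fun d => ContinuousLinearMap.adjoint (A d) ∘L T) v'
  have hu0 : ∀ j < 1, u j = 0 := neumann_eq_zero _ (extendByZero_eq_zero v)
  have hu : ∀ j, u j = lagOp (fun d => ContinuousLinearMap.adjoint (A d) ∘L T) u j + v' j :=
    hB'.neumann_eq hγ hγ1 (norm_extendByZero_le v)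
  have hXm : ∀ s, Measurable (X s) := hB.measurable_neumann hγ hγ1 he.measurable hC
  have hXb : ∀ s, ∃ M, ∀ ω, ‖X s ω‖ ≤ M := fun s =>
    ⟨_, fun ω => hB.norm_neumann_le hγ hγ1 (fun s => hC s ω) s⟩
  set R : Ω → ℝ := fun ω => ∑ d : Fin D, ∑ j ∈ Finset.Icc (1 : ℤ) D,
    if j ≤ D - ((d : ℤ) + 1) then 0 else
      (inner ℝ (T (u j)) (A d (T (X (t - j - ((d : ℤ) + 1)) ω))) : ℝ) with hR
  have hRterm : ∀ (d : Fin D) (j : ℤ) (ω : Ω),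
      (inner ℝ (T (u j)) (A d (T (X (t - j - ((d : ℤ) + 1)) ω))) : ℝ) =
        inner ℝ (ContinuousLinearMap.adjoint (A d ∘L T) (T (u j)))
          (X (t - j - ((d : ℤ) + 1)) ω) := fun d j ω => by
    rw [ContinuousLinearMap.adjoint_inner_left]
    rfl
  have hXL : ∀ (a : H) (s : ℤ), MemLp (fun ω => (inner ℝ a (X s ω) : ℝ)) 2 P := fun a s =>
    memLp_inner_of_bound (hXm s) (hXb s).choose_spec a
  have hRL : MemLp R 2 P := by
    refine memLp_finsetSum _ fun d _ => memLp_finsetSum _ fun j _ => ?_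
    split_ifs
    · exact MemLp.zero
    · simp only [hRterm]
      exact hXL _ _
  have hLHS : ∀ ω, ∫ s : I, ∑ d : Fin D, v d s * X (t - ((d : ℤ) + 1)) ω s =
      ∑ j ∈ Finset.Icc (1 : ℤ) D, (inner ℝ (T (u j)) (e (t - j) ω) : ℝ) + R ω := by
    intro ω
    rw [integral_finsetSum _ fun d _ => hL.integrable_mul _ _, hR,
      ← hT.sum_inner_eq (v := v') (x := fun s => X s ω) (e := fun s => e s ω)
        (hB.neumann_eq hγ hγ1 fun s => hC s ω) hu0 hu, ← sum_fin_eq_sum_Icc]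
    refine Finset.sum_congr rfl fun d _ => ?_
    rw [show v' ((d : ℤ) + 1) = v d from extendByZero_apply v d, ← hT.inner_comm, hT.inner_eq]
  simp only [hLHS]
  refine le_trans ?_ (sum_integral_sq_le (P := P) (Finset.Icc (1 : ℤ) D)
    (f := fun j ω => (inner ℝ (T (u j)) (e (t - j) ω) : ℝ)) (g := R)
    (fun j _ => memLp_inner_of_bound (he.measurable _) (hC _) _) hRL
    (fun i _ j _ hij => he.integral_inner_mul_inner h0 (by omega) _ _) ?_)
  · have h1 := hA'.sum_l2NormSq_le hγ hγ1 hL hK hT hu0 hu D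
    rw [← sum_fin_eq_sum_Icc] at h1
    simp only [v', extendByZero_apply] at h1
    calc κ / 4 * ∑ d, l2NormSq (v d) ≤ κ / 4 * (4 * ∑ j ∈ Finset.Icc (1 : ℤ) D, l2NormSq (u j)) := by
          gcongr
      _ = ∑ j ∈ Finset.Icc (1 : ℤ) D, κ * l2NormSq (u j) := by
          rw [← Finset.mul_sum]
          ring
      _ ≤ _ := by
          refine Finset.sum_le_sum fun j _ => (hlow (t - j) (u j)).trans_eq ?_
          simp only [← hT.inner_comm, hT.inner_eq]
  · intro i hi
    rw [Finset.mem_Icc] at hi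
    have hint : ∀ (d : Fin D) (j : ℤ), Integrable (fun ω => (inner ℝ (T (u i)) (e (t - i) ω) : ℝ) *
        if j ≤ D - ((d : ℤ) + 1) then 0 else
          (inner ℝ (T (u j)) (A d (T (X (t - j - ((d : ℤ) + 1)) ω))) : ℝ)) P := by
      intro d j
      split_ifs
      · simp
      · simp only [hRterm]
        exact (memLp_inner_of_bound (he.measurable _) (hC _) _).integrable_mul (hXL _ _)
    simp only [hR, Finset.mul_sum]
    rw [integral_finsetSum _ fun d _ => integrable_finsetSum _ fun j _ => hint d j]
    refine Finset.sum_eq_zero fun d _ => ?_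
    rw [integral_finsetSum _ fun j _ => hint d j]
    refine Finset.sum_eq_zero fun j hj => ?_
    split_ifs with h
    · simp
    · simp only [hRterm]
      -- Here `j + (d + 1) > D ≥ i`, so this value of `X` lies strictly before the noise at `t - i`.
      exact he.integral_inner_mul_inner_neumann h0 hB hγ hγ1 hC (by omega) _ _

end RestrictedEigenvalue

end FAR

/-! ### Assembly of the theorem -/

namespace FAR

lemma HasPolySup.polyNorm_le {H : Type u} [NormedAddCommGroup H] [InnerProductSpace ℝ H] {D : ℕ}
    {A : Fin D → H →L[ℝ] H} {γ : ℝ} (h : HasPolySup A γ) {z : ℂ} (hz : ‖z‖ ≤ 1) :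
    polyNorm A z ≤ γ :=
  h.1 ⟨z, by simpa using hz, rfl⟩

lemma lagOp_sub {H : Type u} [NormedAddCommGroup H] [InnerProductSpace ℝ H] {D : ℕ}
    (B : Fin D → H →L[ℝ] H) (w w' : ℤ → H) (t : ℤ) :
    lagOp B (fun s => w s - w' s) t = lagOp B w t - lagOp B w' t := by
  simp only [lagOp, map_sub, Finset.sum_sub_distrib]

end FAR

theorem proposition1 :
    ∃ κX : ℝ → ℝ → ℝ,
      (∀ κε γ : ℝ, 0 < κε → 0 ≤ γ → γ < 1 → 0 < κX κε γ) ∧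
      ∀ D : ℕ, ∃ CX : ℝ → ℝ → ℝ,
        (∀ Cε γ : ℝ, 0 < Cε → 0 ≤ γ → γ < 1 → 0 < CX Cε γ) ∧
        ∀ (H : Type u) [NormedAddCommGroup H] [InnerProductSpace ℝ H] [CompleteSpace H]
          [TopologicalSpace.SeparableSpace H] [MeasurableSpace H] [BorelSpace H]
          [RKHS ℝ H unitInterval ℝ]
          (Ω : Type v) [MeasurableSpace Ω] (P : Measure Ω) [IsProbabilityMeasure P]
          (A : Fin D → H →L[ℝ] H) (ε : ℤ → Ω → H) (γ Cε : ℝ),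
          FAR.SubsetL2 H → FAR.ProductRegular H → FAR.KernelBounded H →
          (∀ d, IsCompactOperator (A d)) →
          FAR.HasPolySup A γ → γ < 1 →
          FAR.IsIIDNoise ε P →
          (∀ (t : ℤ) (s : unitInterval), ∫ ω, ε t ω s ∂P = 0) →
          0 < Cε → (∀ t, ∀ᵐ ω ∂P, ‖ε t ω‖ ≤ Cε) →
          ∃ X : ℤ → Ω → H,
            FAR.SolvesFAR A ε X P ∧
            FAR.StrictlyStationary X P ∧ FAR.WeaklyStationary X P ∧
            (∀ Y : ℤ → Ω → H, FAR.SolvesFAR A ε Y P →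
              (FAR.StrictlyStationary Y P ∨ FAR.WeaklyStationary Y P) →
              ∀ t, Y t =ᵐ[P] X t) ∧
            (∀ t, ∀ᵐ ω ∂P, ‖X t ω‖ ≤ CX Cε γ) ∧
            ((∀ d, FiniteDimensional ℝ (LinearMap.range (A d).toLinearMap)) →
              ∀ κε : ℝ, 0 < κε → FAR.NoiseLowerBound ε P κε →
                FAR.RestrictedEigenvalue D X P (κX κε γ)) := by
  -- The `+ 1` in `CX` makes positivity immediate.
  refine ⟨fun κ _ => κ / 4, fun κ γ hκ _ _ => by positivity, fun D =>
    ⟨fun C γ => C * ∑' k : ℕ, γ ^ k * (((k * D : ℕ) : ℝ) + 1) + 1, fun C γ hC hγ _ => ?_, ?_⟩⟩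
  · have : 0 ≤ ∑' k : ℕ, γ ^ k * (((k * D : ℕ) : ℝ) + 1) := tsum_nonneg fun k => by positivity
    positivity
  intro H _ _ _ _ _ _ _ Ω _ P _ A ε γ C hL _ hK _ hsup hγ1 hε h0 hC hεC
  have hsec : SecondCountableTopology H := UniformSpace.secondCountable_of_separable H
  have hpoly : ∀ z : ℂ, ‖z‖ ≤ 1 → FAR.polyNorm A z ≤ γ := fun z hz => hsup.polyNorm_le hz
  have hγ : 0 ≤ γ := le_trans (by unfold FAR.polyNorm; positivity) (hpoly 0 (by simp))
  have hA : FAR.LagBound A γ := FAR.lagBound_of_polyNorm_le hpoly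
  have hA' : FAR.LagBound (fun d => ContinuousLinearMap.adjoint (A d)) γ :=
    FAR.lagBound_of_polyNorm_le fun z hz => by
      rw [FAR.polyNorm_adjoint]
      exact hpoly _ (by simpa using hz)
  obtain ⟨T, hT⟩ := FAR.exists_isL2Op hL hK
  have hB := hA.comp hT.norm_le
  set e : ℤ → Ω → H := fun t ω => FAR.truncate C (ε t ω) with he
  have heε : ∀ t, ∀ᵐ ω ∂P, e t ω = ε t ω := fun t =>
    (hεC t).mono fun ω h => FAR.truncate_of_norm_le h
  have heN : FAR.IsIIDNoise e P := hε.truncate C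
  have heC : ∀ t ω, ‖e t ω‖ ≤ C := fun t ω => FAR.norm_truncate_le hC.le _
  have he0 : ∀ p a, ∫ ω, (inner ℝ a (e p ω) : ℝ) ∂P = 0 := fun p =>
    FAR.integral_inner_eq_zero
      (Integrable.of_bound (heN.measurable p).aestronglyMeasurable C (ae_of_all _ (heC p)))
      fun s => by
        rw [← h0 p s]
        exact integral_congr_ae ((heε p).mono fun ω h => by simp only [h])
  set X : ℤ → Ω → H := fun t ω => FAR.neumann (fun d => A d ∘L T) (fun s => e s ω) t with hX
  have hXm : ∀ t, Measurable (X t) := hB.measurable_neumann hγ hγ1 heN.measurable heC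
  have hXb : ∀ t ω, ‖X t ω‖ ≤ C * ∑' k : ℕ, γ ^ k * (((k * D : ℕ) : ℝ) + 1) := fun t ω =>
    hB.norm_neumann_le hγ hγ1 (fun s => heC s ω) t
  have hXeq : ∀ t, ∀ᵐ ω ∂P,
      X t ω = FAR.lagOp (fun d => A d ∘L T) (fun s => X s ω) t + ε t ω := fun t => by
    filter_upwards [heε t] with ω hω
    rw [← hω]
    exact hB.neumann_eq hγ hγ1 (fun s => heC s ω) t
  have hstrict : FAR.StrictlyStationary X P := hB.strictlyStationary_neumann hγ hγ1 hε hC.le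
  refine ⟨X, (hT.solvesFAR_iff A ε X).2 ⟨hXm, hXeq⟩, hstrict,
    hstrict.weaklyStationary fun t =>
      MemLp.of_bound (hXm t).aestronglyMeasurable _ (ae_of_all _ (hXb t)), ?_, ?_, ?_⟩
  · intro Y hY hstat t
    obtain ⟨hYm, hYeq⟩ := (hT.solvesFAR_iff A ε Y).1 hY
    have hYb : FAR.BoundedInProbability Y P := by
      rcases hstat with h | h
      · exact h.boundedInProbability hYm
      · exact h.boundedInProbability hYm
    have hzero := hB.ae_eq_zero_of_boundedInProbability hγ hγ1 (hYb.sub_of_norm_le hXb)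
      (fun s => by
        filter_upwards [hYeq s, hXeq s] with ω h1 h2
        rw [FAR.lagOp_sub, h1, h2, add_sub_add_right_eq_sub]) t
    filter_upwards [hzero] with ω hω
    exact sub_eq_zero.1 hω
  · exact fun t => ae_of_all _ fun ω => (hXb t ω).trans (by simp)
  · intro _ κ hκ hlow
    refine FAR.restrictedEigenvalue_neumann hL hK hT hγ hγ1 hA hA' heN he0 heC hκ fun t v => ?_
    refine (hlow t v).trans_eq (integral_congr_ae ((heε t).mono fun ω h => ?_))
    simp only [h]
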